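/- Work with problems $P\subseteq\mathbb N^{\mathbb N}\times\mathbb N^{\mathbb N}$: the instances of $P$ are the elements of $\operatorname{dom}(P)=\{p:\exists s\,(p,s)\in P\}$, and $s$ is a solution of $p$ if $(p,s)\in P$. Write $P\leq_{\mathrm{sW}}Q$ (strong Weihrauch reducibility) if there are computable (partial) functionals $\Phi,\Psi$ on $\mathbb N^{\mathbb N}$ such that for every $p\in\operatorname{dom}(P)$, $\Phi(p)$ is defined and lies in $\operatorname{dom}(Q)$, and for every $r$ with $(\Phi(p),r)\in Q$, $\Psi(r)$ is defined and $(p,\Psi(r))\in P$. Write $P\equiv_{\mathrm{sW}}Q$ if $P\leq_{\mathrm{sW}}Q$ and $Q\leq_{\mathrm{sW}}P$. A set of natural numbers is represented by its characteristic function, a finite set of natural numbers by its canonical index, and finitely or countably many functions are combined into one function by means of a computable pairing function. Consider the following problems. * $\widehat{\mathsf C}_{\mathbb N}$ (parallelized closed choice on $\mathbb N$): given a sequence $(f_n)_{n\in\mathbb N}$ of functions $f_n\colon\mathbb N\to\mathbb N$, none of which is surjective, find $g\colon\mathbb N\to\mathbb N$ with $g(n)\notin\operatorname{range}(f_n)$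 for all $n$. * $\mathsf{GAC}$ (graph antichain problem): given a graph $G$ whose vertex set is a subset of $\mathbb N$ (by its vertex set and its edge relation), find a maximal antichain of $G$, that is, a maximal set of vertices no two of which are connected by a path in $G$. * $\mathsf{EMB}$ (e-matroid basis problem): given an e-matroid $(M,e)$, find a basis of it. Here an e-matroid consists of a set $M\subseteq\mathbb N$ and a function $e$ from $\mathbb N$ to the finite subsets of $M$ such that (i) $e(n)\neq\emptyset$ for all $n$; (ii) if $Y\subseteq M$ is finite and $e(n)\subseteq Y$ for some $n$, then $Y=e(m)$ for some $m$; (iii) if $X,Y\subseteq M$ are finite sets outside the range of $e$ and $|X|<|Y|$, then there is $y\in Y$ such that $X\cup\{y\}$ is not in the range of $e$. A set $B\subseteq M$ is a basis if no $e(n)$ is a subset of $B$ and, for every $x\in M\setminus B$, some $e(n)$ is a subset of $B\cup\{x\}$. * $\mathsf{VSB}$ (vector space basis problem): given a countable vector space $V$ over a countable field $K$, where the underlying sets of $K$ and $V$ are subsets of $\mathbb N$ and the field $K$ with its operations, $V$ with its operations, and the constants $0_K$, $1_K$, $0_V$ are all part of the instance, find a basis of $V$ over $K$. Let $\mathsf{VSB}_{\mathbb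 Q}$ be the restriction of $\mathsf{VSB}$ to instances in which $K$ is isomorphic to $\mathbb Q$. **Theorem.** $$\mathsf{GAC}\equiv_{\mathrm{sW}}\mathsf{EMB}\equiv_{\mathrm{sW}}\mathsf{VSB}\equiv_{\mathrm{sW}}\widehat{\mathsf C}_{\mathbb N},$$ and also $\mathsf{VSB}_{\mathbb Q}\equiv_{\mathrm{sW}}\widehat{\mathsf C}_{\mathbb N}$. -/

import Mathlib

namespace Weihrauch

/-! ### Computable functionals on Baire space -/

/-- `ComputableFunctional F` says that the partial value `F p n` is computed, uniformly in the
oracle `p : ℕ → ℕ`, from the input `n` by one oracle program.  This is the uniform version of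
`Nat.RecursiveIn`: the generators and closure rules are the same, but the derivation does not
depend on the oracle. -/
inductive ComputableFunctional : ((ℕ → ℕ) → ℕ →. ℕ) → Prop
  | zero : ComputableFunctional fun _ _ => Part.some 0
  | succ : ComputableFunctional fun _ n => Part.some (n + 1)
  | left : ComputableFunctional fun _ n => Part.some (Nat.unpair n).1
  | right : ComputableFunctional fun _ n => Part.some (Nat.unpair n).2
  | oracle : ComputableFunctional fun p n => Part.some (p n)
  | pair {F H : (ℕ → ℕ) → ℕ →. ℕ} (hF : ComputableFunctional F) (hH : ComputableFunctional H) :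
      ComputableFunctional fun p n => (Nat.pair <$> F p n <*> H p n)
  | comp {F H : (ℕ → ℕ) → ℕ →. ℕ} (hF : ComputableFunctional F) (hH : ComputableFunctional H) :
      ComputableFunctional fun p n => H p n >>= F p
  | prec {F H : (ℕ → ℕ) → ℕ →. ℕ} (hF : ComputableFunctional F) (hH : ComputableFunctional H) :
      ComputableFunctional fun p m =>
        let (a, n) := Nat.unpair m
        n.rec (F p a) fun y IH => do
          let i ← IH
          H p (Nat.pair a (Nat.pair y i))
  | rfind {F : (ℕ → ℕ) → ℕ →. ℕ} (hF : ComputableFunctional F) :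
      ComputableFunctional fun p a =>
        Nat.rfind fun n => (fun m => m = 0) <$> F p (Nat.pair a n)

/-- The partial functional `F` is defined at `p` and maps it to the total function `q`. -/
def MapsTo (F : (ℕ → ℕ) → ℕ →. ℕ) (p q : ℕ → ℕ) : Prop :=
  ∀ n, q n ∈ F p n

/-! ### Weihrauch problems and strong reducibility -/

/-- A Weihrauch problem with instances and solutions in Baire space: the set of all pairs
(instance, solution). -/
abbrev Problem := Set ((ℕ → ℕ) × (ℕ → ℕ))

/-- The instances of a problem: the points that have a solution. -/
def Problem.dom (P : Problem) : Set (ℕ → ℕ) := {p | ∃ s, (p, s) ∈ P}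

/-- Strong Weihrauch reducibility `P ≤_sW Q`. -/
def StrongReducible (P Q : Problem) : Prop :=
  ∃ Φ Ψ : (ℕ → ℕ) → ℕ →. ℕ, ComputableFunctional Φ ∧ ComputableFunctional Ψ ∧
    ∀ p ∈ P.dom, ∃ q, MapsTo Φ p q ∧ q ∈ Q.dom ∧
      ∀ r, (q, r) ∈ Q → ∃ s, MapsTo Ψ r s ∧ (p, s) ∈ P

/-- Strong Weihrauch equivalence `P ≡_sW Q`. -/
def StrongEquiv (P Q : Problem) : Prop := StrongReducible P Q ∧ StrongReducible Q P

/-! ### Codings -/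

/-- The `i`-th function `(p)_i` of the sequence of functions coded by `p`. -/
def column (p : ℕ → ℕ) (i : ℕ) : ℕ → ℕ := fun m => p (Nat.pair i m)

/-- The characteristic function (with values in `{0, 1}`) of a set of natural numbers. -/
noncomputable def charFun (A : Set ℕ) : ℕ → ℕ := A.indicator 1

/-! ### Closed choice on the natural numbers -/

/-- Closed choice `C_ℕ`: given `f`, find a number outside the range of `f`. -/
def closedChoice : Set ((ℕ → ℕ) × ℕ) := {x | x.2 ∉ Set.range x.1}

/-- The parallelization of a problem whose solutions are natural numbers. -/
def parallelization (P : Set ((ℕ → ℕ) × ℕ)) : Problem :=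
  {x | ∀ n, (column x.1 n, x.2 n) ∈ P}

/-! ### Graphs and maximal antichains -/

/-- A countable graph: a set of natural numbers as vertices, with a simple graph on it. -/
structure CountableGraph where
  verts : Set ℕ
  graph : SimpleGraph ℕ
  mem_of_adj : ∀ u v, graph.Adj u v → u ∈ verts ∧ v ∈ verts

/-- A set of vertices no two of which are connected by a path. -/
def CountableGraph.Antichain (G : CountableGraph) (A : Set ℕ) : Prop :=
  A ⊆ G.verts ∧ ∀ u ∈ A, ∀ v ∈ A, u ≠ v → ¬ G.graph.Reachable u v

/-- `p` codes the graph `G`: the characteristic functions of vertex set and edge relation. -/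
def CountableGraph.CodedBy (G : CountableGraph) (p : ℕ → ℕ) : Prop :=
  column p 0 = charFun G.verts ∧
  column p 1 = charFun {m | G.graph.Adj (Nat.unpair m).1 (Nat.unpair m).2}

/-- The graph antichain problem. -/
def GAC : Problem :=
  {x | ∃ (G : CountableGraph) (A : Set ℕ), G.CodedBy x.1 ∧ x.2 = charFun A ∧
    Maximal G.Antichain A}

/-! ### e-matroids and their bases -/

/-- An e-matroid: a ground set with an enumeration of its finite dependent sets. -/
structure EMatroid where
  ground : Set ℕ
  e : ℕ → Finset ℕ
  subset_ground : ∀ n, (e n : Set ℕ) ⊆ ground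
  ne_empty : ∀ n, e n ≠ ∅
  superset : ∀ (n : ℕ) (Y : Finset ℕ), (Y : Set ℕ) ⊆ ground → e n ⊆ Y → ∃ m, e m = Y
  exchange : ∀ X Y : Finset ℕ, (X : Set ℕ) ⊆ ground → (Y : Set ℕ) ⊆ ground →
    X.card < Y.card → (∀ n, e n ≠ X ∧ e n ≠ Y) → ∃ y ∈ Y, ∀ n, e n ≠ insert y X

/-- A (possibly infinite) set is dependent if it contains an enumerated finite set. -/
def EMatroid.Dependent (M : EMatroid) (B : Set ℕ) : Prop := ∃ n, (M.e n : Set ℕ) ⊆ B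

/-- A basis: an independent subset of the ground set that becomes dependent when any further
element is adjoined. -/
def EMatroid.IsBasis (M : EMatroid) (B : Set ℕ) : Prop :=
  B ⊆ M.ground ∧ ¬ M.Dependent B ∧ ∀ x ∈ M.ground, x ∉ B → M.Dependent (insert x B)

/-- `p` codes the e-matroid `M`: the characteristic function of the ground set, and the
enumeration, where a finite set `F` is given by its canonical index `∑ i ∈ F, 2 ^ i`. -/
def EMatroid.CodedBy (M : EMatroid) (p : ℕ → ℕ) : Prop :=
  column p 0 = charFun M.ground ∧ ∀ n, column p 1 n = ∑ i ∈ M.e n, 2 ^ i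

/-- The e-matroid basis problem. -/
def EMB : Problem :=
  {x | ∃ (M : EMatroid) (B : Set ℕ), M.CodedBy x.1 ∧ x.2 = charFun B ∧ M.IsBasis B}

/-! ### Vector spaces and their bases -/

/-- A countable vector space over a countable field: scalars and vectors are natural numbers. -/
structure CountableVectorSpace where
  scalars : Set ℕ
  vectors : Set ℕ
  [field : Field scalars]
  [addCommGroup : AddCommGroup vectors]
  [module : Module scalars vectors]

attribute [instance] CountableVectorSpace.field CountableVectorSpace.addCommGroup
  CountableVectorSpace.module

/-- `p` codes the vector space `V`: the characteristic functions of the sets of scalars and of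
vectors, the operations (with arbitrary values outside their domains), and the constants. -/
def CountableVectorSpace.CodedBy (V : CountableVectorSpace) (p : ℕ → ℕ) : Prop :=
  column p 0 = charFun V.scalars ∧
  (∀ a b : V.scalars, column p 1 (Nat.pair a b) = ((a + b : V.scalars) : ℕ)) ∧
  (∀ a b : V.scalars, column p 2 (Nat.pair a b) = ((a * b : V.scalars) : ℕ)) ∧
  column p 3 = charFun V.vectors ∧
  (∀ u v : V.vectors, column p 4 (Nat.pair u v) = ((u + v : V.vectors) : ℕ)) ∧
  (∀ (a : V.scalars) (v : V.vectors),
    column p 5 (Nat.pair a v) = ((a • v : V.vectors) : ℕ)) ∧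
  column p 6 0 = ((0 : V.scalars) : ℕ) ∧
  column p 6 1 = ((1 : V.scalars) : ℕ) ∧
  column p 6 2 = ((0 : V.vectors) : ℕ)

/-- `B` is a basis: linearly independent and spanning. -/
def CountableVectorSpace.IsBasis (V : CountableVectorSpace) (B : Set V.vectors) : Prop :=
  LinearIndepOn V.scalars id B ∧ Submodule.span V.scalars B = ⊤

/-- The vector space basis problem, the scalar field being part of the instance. -/
def VSB : Problem :=
  {x | ∃ (V : CountableVectorSpace) (B : Set V.vectors), V.CodedBy x.1 ∧
    x.2 = charFun (Subtype.val '' B) ∧ V.IsBasis B}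

/-- The restriction of `VSB` to vector spaces over the field of rational numbers. -/
def VSBRat : Problem :=
  {x | ∃ (V : CountableVectorSpace) (B : Set V.vectors), Nonempty (V.scalars ≃+* ℚ) ∧
    V.CodedBy x.1 ∧ x.2 = charFun (Subtype.val '' B) ∧ V.IsBasis B}

end Weihrauch

/-!
All four problems have the degree of parallelized closed choice on the natural numbers, which can be
used to answer countably many existential questions about an instance at once
(`reducible_parallelization_closedChoice`): the closed choice instance `k ↦ 0` if `k` is a witness,
`k ↦ k + 1` otherwise, omits `0` exactly if there is no witness.

**Upper bounds.** The least vertices of the connected components of a graph form a maximal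
antichain, and the vectors outside the span of the vectors with smaller codes form a basis. Paths
and linear combinations are witnesses for not belonging to these sets, so their complements are
enumerable. In an e-matroid a basis is built greedily by asking for every number and every finite
set whether the number can be added to the set; of these questions, one per number is used.

**Lower bounds.** Given functions `f n`, consider for all `n` and `k` the question whether `f n`
takes the value `k`. A solution of the instance constructed below answers the questions well enough
to find, for every `n`, some `k` outside the range of `f n` by unbounded search.

* For e-matroids, the pairs `(n, f n j)` are declared to be loops; the only basis consists of the
  other pairs.
* For graphs, two vertices are attached to `(n, k)`, and they are joined through a new vertex
  `j + 2` if `f n j = k`. Both belong to a maximal antichain if and only if `k` is not a value.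
* For vector spaces over `ℚ`, two vectors `a`, `b` are attached to `m = (n, k)`, and the relation
  `b = s • a` is imposed if `s` is the least argument with `f n s = k`. The resulting space
  `collapseSpace` has decidable equality, because a linear relation between `a` and `b` reveals the
  only possible `s`; hence vectors can be represented by least codes. Now let a basis be given. It
  expresses positive integer multiples of `a` and `b` as integral combinations of basis vectors. If
  `b = s • a`, comparing coordinates at one basis vector bounds `s` in terms of these expressions
  (`le_of_multiple_add_sum_eq_sum`), so it can be decided from them whether `k` is a value. Checking
  the expressions requires the operations of the space and hence the instance. A strong reduction
  has no access to it other than through the basis, so every vector carries an initial segment of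
  the instance in its code; a basis contains arbitrarily large codes (`exists_mem_basis_gt`) and
  thereby determines the instance.

Computability is handled by `OracleComputable` and `OracleDecidable`, classes of total operations
and predicates on coded types that are closed under the usual constructions and contain all
primitive recursive operations.
-/

namespace Weihrauch

open Encodable

/-! ### Oracle computable operations -/

/-- A total operation `F`, between types with a primitive recursive coding, that is computed by one
oracle program uniformly in the oracle. -/
def OracleComputable {α σ : Type*} [Primcodable α] [Primcodable σ] (F : (ℕ → ℕ) → α → σ) : Prop :=
  ComputableFunctional fun p n =>
    Part.bind (decode (α := α) n) fun a => Part.some (encode (F p a))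

/-- A predicate decided by one oracle program uniformly in the oracle. -/
def OracleDecidable {α : Type*} [Primcodable α] (P : (ℕ → ℕ) → α → Prop) : Prop :=
  ∃ b : (ℕ → ℕ) → α → Bool, OracleComputable b ∧ ∀ p a, b p a = true ↔ P p a

theorem ComputableFunctional.of_eq {F G : (ℕ → ℕ) → ℕ →. ℕ} (hF : ComputableFunctional F)
    (h : ∀ p n, F p n = G p n) : ComputableFunctional G :=
  (funext fun p => funext fun n => h p n : F = G) ▸ hF

theorem ComputableFunctional.of_partrec {f : ℕ →. ℕ} (hf : Nat.Partrec f) :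
    ComputableFunctional fun _ n => f n := by
  induction hf with
  | zero => exact .zero
  | succ => exact .succ
  | left => exact .left
  | right => exact .right
  | pair _ _ hf hg => exact .pair hf hg
  | comp _ _ hf hg => exact .comp hf hg
  | prec _ _ hf hg => exact .prec hf hg
  | rfind _ hf => exact .rfind hf

namespace OracleComputable

variable {α β γ σ : Type*} [Primcodable α] [Primcodable β] [Primcodable γ] [Primcodable σ]

theorem of_primrec {f : α → σ} (hf : Primrec f) : OracleComputable fun _ a => f a :=
  ComputableFunctional.of_partrec hf.to_comp

theorem nat_iff {F : (ℕ → ℕ) → ℕ → ℕ} :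
    OracleComputable F ↔ ComputableFunctional fun p n => Part.some (F p n) := by
  simp [OracleComputable]

theorem comp {G : (ℕ → ℕ) → β → σ} {F : (ℕ → ℕ) → α → β} (hG : OracleComputable G)
    (hF : OracleComputable F) : OracleComputable fun p a => G p (F p a) := by
  have h := ComputableFunctional.comp hG hF
  refine h.of_eq fun p n => ?_
  cases e : decode (α := α) n <;> simp

theorem oracle {F : (ℕ → ℕ) → α → ℕ} (hF : OracleComputable F) :
    OracleComputable fun p a => p (F p a) :=
  comp (G := fun p n => p n) (nat_iff.2 .oracle) hF

theorem pair {F : (ℕ → ℕ) → α → β} {G : (ℕ → ℕ) → α → γ} (hF : OracleComputable F)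
    (hG : OracleComputable G) : OracleComputable fun p a => (F p a, G p a) := by
  have h := ComputableFunctional.pair hF hG
  refine h.of_eq fun p n => ?_
  cases e : decode (α := α) n <;> simp [Seq.seq]

theorem id : OracleComputable fun _ (a : α) => a := of_primrec .id

theorem const (s : σ) : OracleComputable fun _ (_ : α) => s := of_primrec (.const s)

theorem primrec {g : β → σ} {F : (ℕ → ℕ) → α → β} (hg : Primrec g) (hF : OracleComputable F) :
    OracleComputable fun p a => g (F p a) := (of_primrec hg).comp hF

theorem primrec₂ {g : β → γ → σ} {F : (ℕ → ℕ) → α → β} {G : (ℕ → ℕ) → α → γ}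
    (hg : Primrec₂ g) (hF : OracleComputable F) (hG : OracleComputable G) :
    OracleComputable fun p a => g (F p a) (G p a) :=
  (of_primrec (f := fun x : β × γ => g x.1 x.2) hg).comp (hF.pair hG)

theorem fst {F : (ℕ → ℕ) → α → β × γ} (hF : OracleComputable F) :
    OracleComputable fun p a => (F p a).1 := primrec .fst hF

theorem snd {F : (ℕ → ℕ) → α → β × γ} (hF : OracleComputable F) :
    OracleComputable fun p a => (F p a).2 := primrec .snd hF

theorem natPair {F G : (ℕ → ℕ) → α → ℕ} (hF : OracleComputable F) (hG : OracleComputable G) :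
    OracleComputable fun p a => Nat.pair (F p a) (G p a) := primrec₂ Primrec₂.natPair hF hG

theorem unpair₁ {F : (ℕ → ℕ) → α → ℕ} (hF : OracleComputable F) :
    OracleComputable fun p a => (F p a).unpair.1 := fst (primrec .unpair hF)

theorem unpair₂ {F : (ℕ → ℕ) → α → ℕ} (hF : OracleComputable F) :
    OracleComputable fun p a => (F p a).unpair.2 := snd (primrec .unpair hF)

theorem nat_rec {N : (ℕ → ℕ) → α → ℕ} {F : (ℕ → ℕ) → α → σ} {H : (ℕ → ℕ) → α × ℕ × σ → σ}
    (hN : OracleComputable N) (hF : OracleComputable F) (hH : OracleComputable H) :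
    OracleComputable fun p a => (Nat.rec (F p a) (fun y ih => H p (a, y, ih)) (N p a) : σ) := by
  have h := ComputableFunctional.comp (ComputableFunctional.prec hF hH)
    (OracleComputable.pair (OracleComputable.id (α := α)) hN)
  refine h.of_eq fun p n => ?_
  cases e : decode (α := α) n with
  | none => simp
  | some a =>
    simp only [Part.coe_some, Part.bind_some, Part.bind_eq_bind, encode_prod_val, Nat.unpair_pair,
      encode_nat]
    induction N p a with
    | zero => simp
    | succ m ih => simp only [ih]; simp

theorem cond {b : (ℕ → ℕ) → α → Bool} {F G : (ℕ → ℕ) → α → σ} (hb : OracleComputable b)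
    (hF : OracleComputable F) (hG : OracleComputable G) :
    OracleComputable fun p a => bif b p a then F p a else G p a :=
  (of_primrec (f := fun x : Bool × σ × σ => bif x.1 then x.2.1 else x.2.2)
    (Primrec.cond .fst (.comp .fst .snd) (.comp .snd .snd))).comp (hb.pair (hF.pair hG))

theorem ite {P : (ℕ → ℕ) → α → Prop} [∀ p a, Decidable (P p a)] {F G : (ℕ → ℕ) → α → σ}
    (hP : OracleDecidable P) (hF : OracleComputable F) (hG : OracleComputable G) :
    OracleComputable fun p a => if P p a then F p a else G p a := by
  obtain ⟨b, hb, h⟩ := hP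
  refine cast (congrArg _ ?_) (cond hb hF hG)
  funext p a
  by_cases hp : P p a
  · simp [hp, (h p a).2 hp]
  · have : b p a = false := by simpa using mt (h p a).1 hp
    simp [hp, this]

theorem of_eq {F G : (ℕ → ℕ) → α → σ} (hF : OracleComputable F) (h : ∀ p a, F p a = G p a) :
    OracleComputable G :=
  (funext fun p => funext fun n => h p n : F = G) ▸ hF

/-- The fold is a primitive recursion along the length of the list. -/
theorem list_foldl [Inhabited β] {l : (ℕ → ℕ) → α → List β} {F : (ℕ → ℕ) → α → σ}
    {H : (ℕ → ℕ) → α × σ × β → σ} (hl : OracleComputable l) (hF : OracleComputable F)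
    (hH : OracleComputable H) :
    OracleComputable fun p a => (l p a).foldl (fun s b => H p (a, s, b)) (F p a) := by
  have hl' : OracleComputable fun p (x : α × ℕ × σ) => l p x.1 := hl.comp (of_primrec .fst)
  have hH' : OracleComputable fun p (x : α × ℕ × σ) => H p (x.1, x.2.2, (l p x.1).getI x.2.1) :=
    hH.comp (.pair (of_primrec .fst) (.pair (of_primrec (.comp .snd .snd))
      (primrec₂ Primrec.list_getI hl' (of_primrec (.comp .fst .snd)))))
  refine (nat_rec (primrec .list_length hl) hF hH').of_eq fun p a => ?_
  have key : ∀ m ≤ (l p a).length,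
      (Nat.rec (F p a) (fun y ih => H p (a, ih, (l p a).getI y)) m : σ) =
        ((l p a).take m).foldl (fun s b => H p (a, s, b)) (F p a) := by
    intro m hm
    induction m with
    | zero => simp
    | succ m ih =>
      have hm' : m < (l p a).length := hm
      simp only [ih hm'.le, List.take_add_one, List.foldl_append, List.getElem?_eq_getElem hm',
        List.getI_eq_getElem _ hm', Option.toList_some, List.foldl_cons, List.foldl_nil]
  simpa using key _ le_rfl

end OracleComputable

namespace OracleDecidable

variable {α β γ σ : Type*} [Primcodable α] [Primcodable β] [Primcodable γ] [Primcodable σ]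

theorem of_iff {P Q : (ℕ → ℕ) → α → Prop} (hP : OracleDecidable P) (h : ∀ p a, P p a ↔ Q p a) :
    OracleDecidable Q :=
  (funext fun p => funext fun n => propext (h p n) : P = Q) ▸ hP

theorem comp {P : (ℕ → ℕ) → β → Prop} {F : (ℕ → ℕ) → α → β} (hP : OracleDecidable P)
    (hF : OracleComputable F) : OracleDecidable fun p a => P p (F p a) :=
  let ⟨_, hb, h⟩ := hP
  ⟨_, hb.comp hF, fun p a => h p (F p a)⟩

theorem eq [DecidableEq β] {F G : (ℕ → ℕ) → α → β} (hF : OracleComputable F)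
    (hG : OracleComputable G) : OracleDecidable fun p a => F p a = G p a :=
  ⟨_, OracleComputable.primrec₂ Primrec.beq hF hG, by simp⟩

theorem lt {F G : (ℕ → ℕ) → α → ℕ} (hF : OracleComputable F)
    (hG : OracleComputable G) : OracleDecidable fun p a => F p a < G p a :=
  ⟨_, OracleComputable.primrec₂ Primrec.nat_lt.decide hF hG, by simp⟩

theorem and {P Q : (ℕ → ℕ) → α → Prop} (hP : OracleDecidable P) (hQ : OracleDecidable Q) :
    OracleDecidable fun p a => P p a ∧ Q p a :=
  let ⟨b, hb, h⟩ := hP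
  let ⟨c, hc, h'⟩ := hQ
  ⟨_, OracleComputable.primrec₂ Primrec.and hb hc, by simp [h, h']⟩

theorem or {P Q : (ℕ → ℕ) → α → Prop} (hP : OracleDecidable P) (hQ : OracleDecidable Q) :
    OracleDecidable fun p a => P p a ∨ Q p a :=
  let ⟨b, hb, h⟩ := hP
  let ⟨c, hc, h'⟩ := hQ
  ⟨_, OracleComputable.primrec₂ Primrec.or hb hc, by simp [h, h']⟩

theorem not {P : (ℕ → ℕ) → α → Prop} (hP : OracleDecidable P) :
    OracleDecidable fun p a => ¬ P p a :=
  let ⟨b, hb, h⟩ := hP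
  ⟨_, OracleComputable.primrec Primrec.not hb, by simp [← h]⟩

theorem forall_lt {P : (ℕ → ℕ) → α × ℕ → Prop} {N : (ℕ → ℕ) → α → ℕ} (hP : OracleDecidable P)
    (hN : OracleComputable N) : OracleDecidable fun p a => ∀ i < N p a, P p (a, i) := by
  obtain ⟨b, hb, h⟩ := hP
  refine ⟨_, OracleComputable.nat_rec (H := fun p x => x.2.2 && b p (x.1, x.2.1)) hN
    (OracleComputable.const true) ?_, fun p a => ?_⟩
  · exact .primrec₂ Primrec.and (.of_primrec (.comp .snd .snd))
      (hb.comp (.of_primrec (.pair .fst (.comp .fst .snd))))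
  · change _ ↔ ∀ i < N p a, P p (a, i)
    induction N p a with
    | zero => simp
    | succ n ih => simp only [Nat.forall_lt_succ_right, Bool.and_eq_true, ih, h]

theorem exists_lt {P : (ℕ → ℕ) → α × ℕ → Prop} {N : (ℕ → ℕ) → α → ℕ} (hP : OracleDecidable P)
    (hN : OracleComputable N) : OracleDecidable fun p a => ∃ i < N p a, P p (a, i) :=
  (forall_lt hP.not hN).not.of_iff (by simp)

theorem forall_mem [Inhabited β] {P : (ℕ → ℕ) → α × β → Prop} {l : (ℕ → ℕ) → α → List β}
    (hP : OracleDecidable P) (hl : OracleComputable l) :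
    OracleDecidable fun p a => ∀ x ∈ l p a, P p (a, x) := by
  obtain ⟨b, hb, h⟩ := hP
  refine ⟨_, OracleComputable.list_foldl (H := fun p x => x.2.1 && b p (x.1, x.2.2)) hl
    (OracleComputable.const true) ?_, fun p a => ?_⟩
  · exact .primrec₂ Primrec.and (.of_primrec (.comp .fst .snd))
      (hb.comp (.of_primrec (.pair .fst (.comp .snd .snd))))
  · have : ∀ (l : List β) (c : Bool), l.foldl (fun s x => s && b p (a, x)) c = true ↔
        c = true ∧ ∀ x ∈ l, P p (a, x) := by
      intro l
      induction l with
      | nil => simp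
      | cons x l ih => intro c; simp [ih, h, and_assoc]
    simp [this]

end OracleDecidable

/-- Unbounded search: the functional returns `G r (n, w)` for the least `w` with `P r (n, w)`. -/
theorem OracleDecidable.exists_search {P : (ℕ → ℕ) → ℕ × ℕ → Prop} {G : (ℕ → ℕ) → ℕ × ℕ → ℕ}
    (hP : OracleDecidable P) (hG : OracleComputable G) :
    ∃ Ψ, ComputableFunctional Ψ ∧ ∀ r, (∀ n, ∃ w, P r (n, w)) →
      ∃ s, MapsTo Ψ r s ∧
        ∀ n, ∃ w, (P r (n, w) ∧ ∀ v < w, ¬ P r (n, v)) ∧ s n = G r (n, w) := by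
  classical
  obtain ⟨b, hb, h⟩ := hP
  have hf : ComputableFunctional fun p m => Part.some (bif b p m.unpair then 0 else 1) :=
    OracleComputable.nat_iff.1 ((hb.comp (.of_primrec .unpair)).cond (.const 0) (.const 1))
  have hg : ComputableFunctional fun p m => Part.some (G p m.unpair) :=
    OracleComputable.nat_iff.1 (hG.comp (.of_primrec .unpair))
  have hid : ComputableFunctional fun _ n => Part.some n :=
    OracleComputable.nat_iff.1 OracleComputable.id
  refine ⟨_, .comp hg (.pair hid (.rfind hf)), fun r hr => ⟨fun n => G r (n, Nat.find (hr n)),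
    fun n => ?_, fun n => ⟨_, ⟨Nat.find_spec (hr n), fun v hv => Nat.find_min (hr n) hv⟩, rfl⟩⟩⟩
  have hrf : Nat.find (hr n) ∈ Nat.rfind fun k => (fun m => decide (m = 0)) <$>
      (Part.some (bif b r (Nat.pair n k).unpair then 0 else 1) : Part ℕ) := by
    refine Nat.mem_rfind.2 ⟨?_, ?_⟩
    · simp [(h _ _).2 (Nat.find_spec (hr n))]
    · intro m hm
      have := Nat.find_min (hr n) hm
      rw [← h] at this
      simp [this]
  simp only [Part.bind_eq_bind, Part.mem_bind_iff]
  refine ⟨Nat.pair n (Nat.find (hr n)), ?_, by simp⟩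
  simp only [Seq.seq, Part.map_eq_map, Part.map_some, Part.bind_some, Part.mem_map_iff]
  exact ⟨_, hrf, rfl⟩

/-- A total search: the least witness is computable if there always is one. -/
theorem OracleComputable.find {P : (ℕ → ℕ) → ℕ × ℕ → Prop} (hP : OracleDecidable P)
    {F : (ℕ → ℕ) → ℕ → ℕ} (hF : ∀ r n, P r (n, F r n) ∧ ∀ v < F r n, ¬ P r (n, v)) :
    OracleComputable F := by
  obtain ⟨Ψ, hΨ, h⟩ := hP.exists_search (G := fun _ x => x.2) (.of_primrec .snd)
  rw [OracleComputable.nat_iff]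
  refine hΨ.of_eq fun r n => ?_
  obtain ⟨s, hs, hs'⟩ := h r fun n => ⟨_, (hF r n).1⟩
  obtain ⟨w, ⟨hw, hw'⟩, hsw⟩ := hs' n
  have : w = F r n := by
    rcases lt_trichotomy w (F r n) with h1 | h1 | h1
    · exact absurd hw ((hF r n).2 _ h1)
    · exact h1
    · exact absurd (hF r n).1 (hw' _ h1)
  have e : s n = F r n := hsw.trans this
  exact Part.eq_some_iff.2 (e ▸ hs n)

/-! ### Composition of functionals -/

/-- Substitution of a functional for the oracle of another one. -/
theorem ComputableFunctional.subst {F Φ : (ℕ → ℕ) → ℕ →. ℕ} (hF : ComputableFunctional F)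
    (hΦ : ComputableFunctional Φ) :
    ∃ F', ComputableFunctional F' ∧ ∀ p q, MapsTo Φ p q → F' p = F q := by
  induction hF with
  | zero => exact ⟨_, .zero, fun _ _ _ => rfl⟩
  | succ => exact ⟨_, .succ, fun _ _ _ => rfl⟩
  | left => exact ⟨_, .left, fun _ _ _ => rfl⟩
  | right => exact ⟨_, .right, fun _ _ _ => rfl⟩
  | oracle => exact ⟨_, hΦ, fun p q h => funext fun n => Part.eq_some_iff.2 (h n)⟩
  | pair _ _ h1 h2 =>
    obtain ⟨F1, hF1, h1⟩ := h1
    obtain ⟨F2, hF2, h2⟩ := h2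
    exact ⟨_, .pair hF1 hF2, fun p q h => by simp only [h1 p q h, h2 p q h]; rfl⟩
  | comp _ _ h1 h2 =>
    obtain ⟨F1, hF1, h1⟩ := h1
    obtain ⟨F2, hF2, h2⟩ := h2
    exact ⟨_, .comp hF1 hF2, fun p q h => by simp only [h1 p q h, h2 p q h]; rfl⟩
  | prec _ _ h1 h2 =>
    obtain ⟨F1, hF1, h1⟩ := h1
    obtain ⟨F2, hF2, h2⟩ := h2
    exact ⟨_, .prec hF1 hF2, fun p q h => by simp only [h1 p q h, h2 p q h]; rfl⟩
  | rfind _ h1 =>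
    obtain ⟨F1, hF1, h1⟩ := h1
    exact ⟨_, .rfind hF1, fun p q h => by simp only [h1 p q h]; rfl⟩

theorem StrongReducible.trans {P Q R : Problem} (hPQ : StrongReducible P Q)
    (hQR : StrongReducible Q R) : StrongReducible P R := by
  obtain ⟨Φ, Ψ, hΦ, hΨ, h⟩ := hPQ
  obtain ⟨Φ', Ψ', hΦ', hΨ', h'⟩ := hQR
  obtain ⟨Φ₂, hΦ₂, e⟩ := hΦ'.subst hΦ
  obtain ⟨Ψ₂, hΨ₂, e'⟩ := hΨ.subst hΨ'
  refine ⟨Φ₂, Ψ₂, hΦ₂, hΨ₂, fun p hp => ?_⟩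
  obtain ⟨q, hq, hqQ, hs⟩ := h p hp
  obtain ⟨q', hq', hqR, hs'⟩ := h' q hqQ
  refine ⟨q', fun n => by rw [e p q hq]; exact hq' n, hqR, fun r hr => ?_⟩
  obtain ⟨s', hs1, hs2⟩ := hs' r hr
  obtain ⟨s, hs3, hs4⟩ := hs s' hs2
  exact ⟨s, fun n => by rw [e' r s' hs1]; exact hs3 n, hs4⟩

/-! ### Problems below parallelized closed choice -/

theorem charFun_eq_one {A : Set ℕ} {n : ℕ} : charFun A n = 1 ↔ n ∈ A := by
  simp [charFun, Set.indicator]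

theorem charFun_eq_zero {A : Set ℕ} {n : ℕ} : charFun A n = 0 ↔ n ∉ A := by
  simp [charFun, Set.indicator]

theorem charFun_injective {A B : Set ℕ} (h : charFun A = charFun B) : A = B := by
  ext n
  rw [← charFun_eq_one, h, charFun_eq_one]

theorem mem_parallelization_closedChoice {q r : ℕ → ℕ} :
    (q, r) ∈ parallelization closedChoice ↔ ∀ n k, q (Nat.pair n k) ≠ r n := by
  simp [parallelization, closedChoice, column]

/-- Parallelized closed choice answers countably many existential questions at once: the instance
`k ↦ if R p (v, k) then 0 else k + 1` omits `0` exactly if there is no witness, and any other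
omitted number comes from a witness. -/
theorem reducible_parallelization_closedChoice {P : Problem} {R : (ℕ → ℕ) → ℕ × ℕ → Prop}
    (hR : OracleDecidable R) {Ψ : (ℕ → ℕ) → ℕ →. ℕ} (hΨ : ComputableFunctional Ψ)
    (H : ∀ p ∈ P.dom, ∀ r : ℕ → ℕ, (∀ v, r v = 0 ↔ ∀ k, ¬ R p (v, k)) →
      ∃ s, MapsTo Ψ r s ∧ (p, s) ∈ P) :
    StrongReducible P (parallelization closedChoice) := by
  classical
  have hΦ : OracleComputable fun p n => if R p (Nat.unpair n) then 0 else n.unpair.2 + 1 :=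
    .ite (hR.comp (.of_primrec .unpair)) (.const 0) (.primrec .succ (.unpair₂ .id))
  refine ⟨_, Ψ, OracleComputable.nat_iff.1 hΦ, hΨ, fun p hp => ⟨_, fun n => Part.mem_some _, ?_,
    fun r hr => H p hp r fun v => ?_⟩⟩
  · refine ⟨fun v => if h : ∃ k, R p (v, k) then h.choose + 1 else 0, ?_⟩
    rw [mem_parallelization_closedChoice]
    intro v k
    simp only [Nat.unpair_pair]
    by_cases h : ∃ k, R p (v, k)
    · by_cases hk : R p (v, k)
      · simp [h, hk]
      · have : k ≠ h.choose := fun e => hk (e ▸ h.choose_spec)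
        simpa [h, hk] using this
    · have hk : ¬ R p (v, k) := fun hk => h ⟨k, hk⟩
      simp [h, hk]
  · rw [mem_parallelization_closedChoice] at hr
    refine ⟨fun h0 k hk => hr v k (by simp [hk, h0]), fun h => ?_⟩
    by_contra h0
    exact hr v (r v - 1) (by simp [h]; omega)

/-- Problems with a solution that is co-enumerable uniformly in the instance. -/
theorem reducible_of_coenumerable_solution {P : Problem} {R : (ℕ → ℕ) → ℕ × ℕ → Prop}
    (hR : OracleDecidable R)
    (H : ∀ p ∈ P.dom, (p, charFun {v | ∀ k, ¬ R p (v, k)}) ∈ P) :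
    StrongReducible P (parallelization closedChoice) := by
  have hΨ : OracleComputable fun r n => if r n = 0 then 1 else 0 :=
    .ite (.eq (.oracle .id) (.const 0)) (.const 1) (.const 0)
  refine reducible_parallelization_closedChoice hR (OracleComputable.nat_iff.1 hΨ)
    fun p hp r hr => ⟨_, fun n => Part.mem_some _, ?_⟩
  convert H p hp using 2
  funext v
  have e : r v = 0 ↔ v ∈ {v | ∀ k, ¬ R p (v, k)} := hr v
  by_cases h : r v = 0
  · rw [if_pos h, charFun_eq_one.2 (e.1 h)]
  · rw [if_neg h, charFun_eq_zero.2 (mt e.2 h)]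

/-! #### Maximal antichains -/

/-- The state `(current vertex, number of missing edges)` after following a list of vertices. -/
def followPath (p : ℕ → ℕ) (v : ℕ) (l : List ℕ) : ℕ × ℕ :=
  l.foldl (fun s u => (u, if p (Nat.pair 1 (Nat.pair s.1 u)) = 1 then s.2 else s.2 + 1)) (v, 0)

theorem followPath_append (p : ℕ → ℕ) (v u : ℕ) (l : List ℕ) :
    followPath p v (l ++ [u]) = (u, if p (Nat.pair 1 (Nat.pair (followPath p v l).1 u)) = 1
      then (followPath p v l).2 else (followPath p v l).2 + 1) := by
  rw [followPath, List.foldl_append]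
  rfl

theorem CountableGraph.CodedBy.adj_iff {G : CountableGraph} {p : ℕ → ℕ} (h : G.CodedBy p)
    {u v : ℕ} : p (Nat.pair 1 (Nat.pair u v)) = 1 ↔ G.graph.Adj u v := by
  have := congrFun h.2 (Nat.pair u v)
  rw [column] at this
  rw [this, charFun_eq_one]
  simp

theorem CountableGraph.CodedBy.reachable_iff {G : CountableGraph} {p : ℕ → ℕ} (h : G.CodedBy p)
    {u v : ℕ} : G.graph.Reachable v u ↔ ∃ l, followPath p v l = (u, 0) := by
  constructor
  · rw [SimpleGraph.reachable_iff_reflTransGen]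
    intro hr
    induction hr with
    | refl => exact ⟨[], rfl⟩
    | tail _ hbc ih =>
      obtain ⟨l, hl⟩ := ih
      exact ⟨l ++ [_], by rw [followPath_append, hl, if_pos (h.adj_iff.2 hbc)]⟩
  · rintro ⟨l, hl⟩
    induction l using List.reverseRecOn generalizing u with
    | nil => obtain rfl : v = u := by simpa [followPath] using hl
             exact .rfl
    | append_singleton l b ih =>
      rw [followPath_append] at hl
      obtain ⟨rfl, h2⟩ := Prod.mk.inj hl
      split_ifs at h2 with ha
      · exact (ih (Prod.ext rfl h2)).trans (h.adj_iff.1 ha).reachable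

/-- The least vertices of the connected components form a maximal antichain. -/
theorem CountableGraph.maximal_antichain_least (G : CountableGraph) :
    Maximal G.Antichain {v | v ∈ G.verts ∧ ∀ u < v, ¬ G.graph.Reachable v u} := by
  refine ⟨⟨fun v hv => hv.1, fun u hu v hv huv hr => ?_⟩, fun B hB hAB w hw => ?_⟩
  · rcases lt_or_gt_of_ne huv with h | h
    · exact hv.2 u h hr.symm
    · exact hu.2 v h hr
  · classical
    have hex : ∃ u, G.graph.Reachable w u := ⟨w, .rfl⟩
    have hmin := Nat.find_spec hex
    by_cases e : Nat.find hex = w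
    · exact ⟨hB.1 hw, fun u hu hr => Nat.find_min hex (by rwa [e]) hr⟩
    refine absurd hmin (hB.2 w hw _ (hAB ⟨?_, fun u hu hr => ?_⟩) (Ne.symm e))
    · generalize Nat.find hex = m at e hmin
      obtain ⟨q⟩ := hmin.symm
      cases q with
      | nil => exact absurd rfl e
      | cons hadj _ => exact (G.mem_of_adj _ _ hadj).1
    · exact Nat.find_min hex hu (hmin.trans hr)

theorem GAC_reducible_parallelization_closedChoice :
    StrongReducible GAC (parallelization closedChoice) := by
  have hfollow : OracleComputable fun p (x : ℕ × ℕ) =>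
      followPath p x.1 (Denumerable.ofNat (List ℕ) x.2) := by
    refine .list_foldl (α := ℕ × ℕ) (β := ℕ) (H := fun p x =>
      (x.2.2, if p (Nat.pair 1 (Nat.pair x.2.1.1 x.2.2)) = 1 then x.2.1.2 else x.2.1.2 + 1))
      (.of_primrec (.comp (.ofNat _) .snd)) (.of_primrec (.pair .fst (.const 0)))
      (.pair (.of_primrec (.comp .snd .snd)) ?_)
    refine .ite (.eq (.oracle (.natPair (.const 1) (.natPair (.of_primrec ?_) (.of_primrec ?_))))
      (.const 1)) (.of_primrec ?_) (.of_primrec (Primrec.succ.comp ?_))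
    · exact .comp .fst (.comp .fst .snd)
    · exact .comp .snd .snd
    · exact .comp .snd (.comp .fst .snd)
    · exact .comp .snd (.comp .fst .snd)
  refine reducible_of_coenumerable_solution (R := fun p x => p (Nat.pair 0 x.1) ≠ 1 ∨
    ((followPath p x.1 (Denumerable.ofNat (List ℕ) x.2)).1 < x.1 ∧
      (followPath p x.1 (Denumerable.ofNat (List ℕ) x.2)).2 = 0))
    (.or (.not (.eq (.oracle (.natPair (.const 0) (.of_primrec .fst))) (.const 1)))
      (.and (.lt hfollow.fst (.of_primrec .fst)) (.eq hfollow.snd (.const 0)))) ?_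
  rintro p ⟨s, G, A, hG, -, -⟩
  refine ⟨G, _, hG, rfl, ?_⟩
  convert G.maximal_antichain_least using 1
  ext v
  have h0 : p (Nat.pair 0 v) = charFun G.verts v := congrFun hG.1 v
  simp only [Set.mem_ofPred_eq, h0, ne_eq, charFun_eq_one, hG.reachable_iff, not_or, not_not,
    not_and, not_exists]
  constructor
  · intro h
    refine ⟨(h 0).1, fun u hu l hl => (h (encode l)).2 ?_ ?_⟩ <;> simp [hl, hu]
  · exact fun h k => ⟨h.1, fun h1 h2 => h.2 _ h1 _ (Prod.ext rfl h2)⟩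

/-! #### Bases of e-matroids -/

theorem primrec₂_pow : Primrec₂ fun a b : ℕ => a ^ b :=
  Primrec₂.unpaired'.1 Nat.Primrec.pow

/-- The canonical index of the part below `n` of the set built greedily: the number `n` is added to
the set with index `c` if the oracle gives the answer `0` to the question `(n, c + 2 ^ n)`. -/
def greedyIndex (r : ℕ → ℕ) (n : ℕ) : ℕ :=
  Nat.rec 0 (fun y c => if r (Nat.pair y (c + 2 ^ y)) = 0 then c + 2 ^ y else c) n

/-- The set built greedily from the answers of the oracle. -/
def greedySet (r : ℕ → ℕ) : Set ℕ := {n | r (Nat.pair n (greedyIndex r n + 2 ^ n)) = 0}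

open Classical in
theorem greedyIndex_eq (r : ℕ → ℕ) (n : ℕ) :
    greedyIndex r n = ∑ i ∈ (Finset.range n).filter (· ∈ greedySet r), 2 ^ i := by
  induction n with
  | zero => rfl
  | succ n ih =>
    rw [Finset.range_add_one, Finset.filter_insert]
    have e : greedyIndex r (n + 1) = if r (Nat.pair n (greedyIndex r n + 2 ^ n)) = 0 then
      greedyIndex r n + 2 ^ n else greedyIndex r n := rfl
    have hmem : n ∈ greedySet r ↔ r (Nat.pair n (greedyIndex r n + 2 ^ n)) = 0 := .rfl
    by_cases h : n ∈ greedySet r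
    · rw [e, if_pos (hmem.1 h), if_pos h, Finset.sum_insert (by simp), ih, add_comm]
    · rw [e, if_neg (mt hmem.2 h), if_neg h, ih]

/-- Greedy bases: if every element is tested against the earlier chosen ones, the result is a
basis, since the largest element of a dependent finite subset would have been rejected. -/
theorem EMatroid.isBasis_of_greedy (M : EMatroid) (B : Set ℕ)
    (hB : ∀ n, n ∈ B ↔ n ∈ M.ground ∧ ¬ M.Dependent (insert n {i | i < n ∧ i ∈ B})) :
    M.IsBasis B := by
  refine ⟨fun n hn => ((hB n).1 hn).1, ?_, fun x hx hxB => ?_⟩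
  · rintro ⟨k, hk⟩
    have hne : (M.e k).Nonempty := Finset.nonempty_iff_ne_empty.2 (M.ne_empty k)
    refine ((hB _).1 (hk (Finset.max'_mem _ hne))).2 ⟨k, fun i hi => ?_⟩
    rcases (Finset.le_max' _ i hi).lt_or_eq with h | h
    · exact Or.inr ⟨h, hk hi⟩
    · exact Or.inl h
  · by_contra hd
    refine hxB ((hB x).2 ⟨hx, fun ⟨k, hk⟩ => hd ⟨k, hk.trans ?_⟩⟩)
    exact Set.insert_subset_insert fun i hi => hi.2

theorem EMatroid.dependent_iff (M : EMatroid) (Y : Finset ℕ) (hY : (Y : Set ℕ) ⊆ M.ground) :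
    M.Dependent Y ↔ ∃ n, M.e n = Y :=
  ⟨fun ⟨n, hn⟩ => M.superset n Y hY (by exact_mod_cast hn),
    fun ⟨n, hn⟩ => ⟨n, by rw [hn]⟩⟩

theorem EMB_reducible_parallelization_closedChoice :
    StrongReducible EMB (parallelization closedChoice) := by
  classical
  have hc : OracleComputable greedyIndex := by
    refine .nat_rec (H := fun r x => if r (Nat.pair x.2.1 (x.2.2 + 2 ^ x.2.1)) = 0 then
      x.2.2 + 2 ^ x.2.1 else x.2.2) .id (.const 0) ?_
    have h1 : OracleComputable fun _ (x : ℕ × ℕ × ℕ) => x.2.2 + 2 ^ x.2.1 :=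
      .of_primrec (Primrec.nat_add.comp (.comp .snd .snd) (primrec₂_pow.comp (.const 2)
        (.comp .fst .snd)))
    exact .ite (.eq (.oracle (.natPair (.of_primrec (.comp .fst .snd)) h1)) (.const 0)) h1
      (.of_primrec (.comp .snd .snd))
  have hΨ : OracleComputable fun r n =>
      if r (Nat.pair n (greedyIndex r n + 2 ^ n)) = 0 then 1 else 0 :=
    .ite (.eq (.oracle (.natPair .id (.primrec₂ Primrec.nat_add hc
      (.of_primrec (primrec₂_pow.comp (.const 2) .id))))) (.const 0)) (.const 1) (.const 0)
  refine reducible_parallelization_closedChoice (R := fun p x =>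
    p (Nat.pair 0 x.1.unpair.1) ≠ 1 ∨ p (Nat.pair 1 x.2) = x.1.unpair.2) ?_
    (OracleComputable.nat_iff.1 hΨ) ?_
  · exact .or (.not (.eq (.oracle (.natPair (.const 0) (.unpair₁ (.of_primrec .fst)))) (.const 1)))
      (.eq (.oracle (.natPair (.const 1) (.of_primrec .snd))) (.unpair₂ (.of_primrec .fst)))
  rintro p ⟨t, M, C, ⟨h0, h1⟩, -, -⟩ r hr
  refine ⟨charFun (greedySet r), fun n => ?_, M, _, ⟨h0, h1⟩, rfl, ?_⟩
  · by_cases h : n ∈ greedySet r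
    · rw [charFun_eq_one.2 h]
      simpa [greedySet] using h
    · rw [charFun_eq_zero.2 h]
      simpa [greedySet] using h
  have hmem : ∀ n, n ∈ greedySet r ↔ n ∈ M.ground ∧
      ∀ k, M.e k ≠ insert n ((Finset.range n).filter (· ∈ greedySet r)) := by
    intro n
    have e0 : ∀ n, p (Nat.pair 0 n) = charFun M.ground n := fun n => congrFun h0 n
    have e1 : ∀ n, p (Nat.pair 1 n) = ∑ i ∈ M.e n, 2 ^ i := h1
    have e2 : greedyIndex r n + 2 ^ n =
        ∑ i ∈ insert n ((Finset.range n).filter (· ∈ greedySet r)), 2 ^ i := by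
      rw [Finset.sum_insert (by simp), greedyIndex_eq, add_comm]
    change r _ = 0 ↔ _
    rw [hr]
    simp only [Nat.unpair_pair, e0, e1, e2, ne_eq, charFun_eq_one, not_or, not_not,
      (Finset.geomSum_injective le_rfl).eq_iff, forall_and, forall_const]
  have hground : greedySet r ⊆ M.ground := fun n hn => ((hmem n).1 hn).1
  refine M.isBasis_of_greedy _ fun n => (hmem n).trans (and_congr_right fun hn => ?_)
  rw [← not_exists, ← M.dependent_iff]
  · refine not_congr (iff_of_eq (congrArg _ ?_))
    ext i
    simp
  · intro i hi
    rcases Finset.mem_insert.1 (Finset.mem_coe.1 hi) with rfl | h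
    · exact hn
    · exact hground (Finset.mem_filter.1 h).2

/-! ### Closed choice from graphs and e-matroids -/

theorem primrec_testBit : Primrec fun x : ℕ × ℕ => x.1 / 2 ^ x.2 % 2 :=
  Primrec.nat_mod.comp (Primrec.nat_div.comp .fst (primrec₂_pow.comp (.const 2) .snd)) (.const 2)

/-- An enumeration of the finite sets that contain a value of `f`: the pair `(i, D)` stands for the
finite set with canonical index `D` if this set contains `f i`, and for `{f i}` otherwise. -/
def loopEnum (f : ℕ → ℕ) (m : ℕ) : Finset ℕ :=
  if m.unpair.2.testBit (f m.unpair.1) then m.unpair.2.bitIndices.toFinset else {f m.unpair.1}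

theorem mem_loopEnum (f : ℕ → ℕ) (m : ℕ) : f m.unpair.1 ∈ loopEnum f m := by
  unfold loopEnum
  split_ifs with h
  · simpa using h
  · simp

theorem exists_loopEnum_eq {f : ℕ → ℕ} {Y : Finset ℕ} {i : ℕ} (hi : f i ∈ Y) :
    ∃ m, loopEnum f m = Y := by
  refine ⟨Nat.pair i (∑ i ∈ Y, 2 ^ i), ?_⟩
  have h : (∑ i ∈ Y, 2 ^ i).testBit (f i) := by
    rw [← Nat.mem_bitIndices, ← List.mem_toFinset]
    simpa using hi
  simp [loopEnum, h]

/-- The e-matroid on `ℕ` whose loops are the values of `f` and which has no other circuits. -/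
def loopMatroid (f : ℕ → ℕ) : EMatroid where
  ground := Set.univ
  e := loopEnum f
  subset_ground _ := Set.subset_univ _
  ne_empty m := Finset.ne_empty_of_mem (mem_loopEnum f m)
  superset m _ _ hY := exists_loopEnum_eq (hY (mem_loopEnum f m))
  exchange X Y _ _ hcard hXY := by
    -- independent sets are those without loops, so every element of `Y` can be adjoined to `X`
    obtain ⟨y, hy⟩ := Finset.card_pos.1 (Nat.zero_lt_of_lt hcard)
    refine ⟨y, hy, fun m hm => ?_⟩
    rcases Finset.mem_insert.1 (hm ▸ mem_loopEnum f m) with h | h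
    · obtain ⟨n, hn⟩ := exists_loopEnum_eq (h ▸ hy)
      exact (hXY n).2 hn
    · obtain ⟨n, hn⟩ := exists_loopEnum_eq h
      exact (hXY n).1 hn

theorem loopMatroid_dependent_iff {f : ℕ → ℕ} {B : Set ℕ} :
    (loopMatroid f).Dependent B ↔ ∃ i, f i ∈ B := by
  constructor
  · rintro ⟨m, hm⟩
    exact ⟨m.unpair.1, hm (mem_loopEnum f m)⟩
  · rintro ⟨i, hi⟩
    refine ⟨Nat.pair i 0, ?_⟩
    simpa [loopMatroid, loopEnum] using hi

theorem loopMatroid_isBasis_iff {f : ℕ → ℕ} {B : Set ℕ} :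
    (loopMatroid f).IsBasis B ↔ B = (Set.range f)ᶜ := by
  simp only [EMatroid.IsBasis, loopMatroid_dependent_iff]
  constructor
  · rintro ⟨-, h1, h2⟩
    ext x
    constructor
    · rintro hx ⟨i, rfl⟩
      exact h1 ⟨i, hx⟩
    · intro hx
      by_contra hxB
      obtain ⟨i, hi⟩ := h2 x trivial hxB
      rcases hi with h | h
      · exact hx ⟨i, h⟩
      · exact h1 ⟨i, h⟩
  · rintro rfl
    refine ⟨Set.subset_univ _, ?_, fun x _ hx => ?_⟩
    · rintro ⟨i, hi⟩
      exact hi ⟨i, rfl⟩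
    · obtain ⟨i, rfl⟩ := not_not.1 hx
      exact ⟨i, Or.inl rfl⟩

/-- The loops record the pairs `(n, k)` such that `k` is a value of the `n`-th function. -/
theorem parallelization_closedChoice_reducible_EMB :
    StrongReducible (parallelization closedChoice) EMB := by
  let loop : (ℕ → ℕ) → ℕ → ℕ := fun p i => Nat.pair i.unpair.1 (p i)
  have hloop : OracleComputable loop := .natPair (.unpair₁ .id) (.oracle .id)
  have hΦ : OracleComputable fun p (n : ℕ) => if n.unpair.1 = 0 then 1 else
      if n.unpair.2.unpair.2 / 2 ^ (loop p n.unpair.2.unpair.1) % 2 = 1 then n.unpair.2.unpair.2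
      else 2 ^ (loop p n.unpair.2.unpair.1) := by
    have hl : OracleComputable fun p (n : ℕ) => loop p n.unpair.2.unpair.1 :=
      hloop.comp (.unpair₁ (.unpair₂ .id))
    have hD : OracleComputable fun _ (n : ℕ) => n.unpair.2.unpair.2 := .unpair₂ (.unpair₂ .id)
    exact .ite (.eq (.unpair₁ .id) (.const 0)) (.const 1)
      (.ite (.eq (.primrec primrec_testBit (.pair hD hl)) (.const 1)) hD
        (.primrec₂ primrec₂_pow (.const 2) hl))
  obtain ⟨Ψ, hΨ, hΨs⟩ := OracleDecidable.exists_search (P := fun r x => r (Nat.pair x.1 x.2) = 1)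
    (G := fun _ x => x.2) (.eq (.oracle (.of_primrec Primrec₂.natPair)) (.const 1))
    (.of_primrec .snd)
  refine ⟨_, Ψ, OracleComputable.nat_iff.1 hΦ, hΨ, fun p ⟨t, ht⟩ => ?_⟩
  set q : ℕ → ℕ := fun n => if n.unpair.1 = 0 then 1 else
      if n.unpair.2.unpair.2 / 2 ^ (loop p n.unpair.2.unpair.1) % 2 = 1 then n.unpair.2.unpair.2
      else 2 ^ (loop p n.unpair.2.unpair.1) with hq
  have hcode : (loopMatroid (loop p)).CodedBy q := by
    constructor
    · funext n
      simp [hq, column, charFun, loopMatroid]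
    · intro n
      simp only [hq, column, loopMatroid, loopEnum, Nat.unpair_pair, one_ne_zero, if_false,
        Nat.testBit_eq_decide_div_mod_eq, decide_eq_true_eq]
      split_ifs <;> simp
  have hrange : ∀ n k, Nat.pair n k ∈ (Set.range (loop p))ᶜ ↔ ∀ j, p (Nat.pair n j) ≠ k := by
    intro n k
    rw [Set.mem_compl_iff, not_iff_comm, not_forall]
    constructor
    · rintro ⟨j, hj⟩
      exact ⟨Nat.pair n j, by simp [loop, not_not.1 hj]⟩
    · rintro ⟨i, hi⟩
      obtain ⟨h1, h2⟩ := Nat.pair_eq_pair.1 hi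
      exact ⟨i.unpair.2, by rw [← h1, Nat.pair_unpair, not_not]; exact h2⟩
  rw [mem_parallelization_closedChoice] at ht
  refine ⟨q, fun n => Part.mem_some _, ⟨_, _, _, hcode, rfl, loopMatroid_isBasis_iff.2 rfl⟩,
    fun r ⟨M, B, hM, hr, hB⟩ => ?_⟩
  have hMe : M.Dependent = (loopMatroid (loop p)).Dependent ∧
      M.ground = (loopMatroid (loop p)).ground := by
    have he : M.e = (loopMatroid (loop p)).e := funext fun n =>
      Finset.geomSum_injective le_rfl ((hM.2 n).symm.trans (hcode.2 n))
    refine ⟨?_, charFun_injective (hM.1.symm.trans hcode.1)⟩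
    funext B
    simp only [EMatroid.Dependent, he]
  have hB' : B = (Set.range (loop p))ᶜ := by
    rw [← loopMatroid_isBasis_iff]
    unfold EMatroid.IsBasis at hB ⊢
    rwa [hMe.1, hMe.2] at hB
  have hr' : r = charFun B := hr
  obtain ⟨s, hs, hs'⟩ := hΨs r fun n => ⟨t n, by
    simp only [hr', hB']
    exact charFun_eq_one.2 ((hrange _ _).2 (ht n))⟩
  refine ⟨s, hs, mem_parallelization_closedChoice.2 fun n => ?_⟩
  obtain ⟨w, ⟨hw, -⟩, hsw⟩ := hs' n
  simp only [hr', hB'] at hw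
  rw [hsw]
  exact (hrange _ _).1 (charFun_eq_one.1 hw)

/-- The vertex `((n, k), i)` with `i < 2` is always present, the vertex `((n, k), j + 2)` is present
if the `n`-th function takes the value `k` at `j`. -/
def IsRangeVertex (p : ℕ → ℕ) (v : ℕ) : Prop :=
  v.unpair.2 < 2 ∨ p (Nat.pair v.unpair.1.unpair.1 (v.unpair.2 - 2)) = v.unpair.1.unpair.2

/-- For all `n` and `k` the vertices `((n, k), 0)` and `((n, k), 1)` are isolated if the `n`-th
function does not take the value `k`; otherwise they are connected through the vertices
`((n, k), j + 2)` for the arguments `j` where it does. -/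
def rangeGraph (p : ℕ → ℕ) : CountableGraph where
  verts := {v | IsRangeVertex p v}
  graph :=
    { Adj := fun u v => (u.unpair.1 = v.unpair.1 ∧ u ≠ v) ∧
        (IsRangeVertex p u ∧ IsRangeVertex p v) ∧ (1 < u.unpair.2 ∨ 1 < v.unpair.2)
      symm := ⟨fun _ _ h => ⟨⟨h.1.1.symm, h.1.2.symm⟩, h.2.1.symm, h.2.2.symm⟩⟩
      loopless := ⟨fun _ h => h.1.2 rfl⟩ }
  mem_of_adj _ _ h := h.2.1

theorem rangeGraph_reachable {p : ℕ → ℕ} {n k j : ℕ} (h : p (Nat.pair n j) = k) :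
    (rangeGraph p).graph.Reachable (Nat.pair (Nat.pair n k) 0) (Nat.pair (Nat.pair n k) 1) := by
  have h1 : ∀ i < 2, (rangeGraph p).graph.Adj (Nat.pair (Nat.pair n k) i)
      (Nat.pair (Nat.pair n k) (j + 2)) := fun i hi => by
    refine ⟨⟨by simp, fun e => ?_⟩, ⟨Or.inl (by rw [Nat.unpair_pair]; exact hi), Or.inr (by simpa)⟩, Or.inr (by simp)⟩
    have := (Nat.pair_eq_pair.1 e).2
    omega
  exact (h1 0 (by norm_num)).reachable.trans (h1 1 (by norm_num)).reachable.symm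

theorem rangeGraph_isolated {p : ℕ → ℕ} {n k i : ℕ} (h : ∀ j, p (Nat.pair n j) ≠ k) (hi : i < 2)
    {v : ℕ} (hv : (rangeGraph p).graph.Reachable (Nat.pair (Nat.pair n k) i) v) :
    v = Nat.pair (Nat.pair n k) i := by
  obtain ⟨w⟩ := hv
  cases w with
  | nil => rfl
  | cons hadj _ =>
    obtain ⟨⟨h1, -⟩, ⟨-, h2⟩, h3⟩ := hadj
    simp only [Nat.unpair_pair] at h1 h3
    rcases h2 with h2 | h2
    · omega
    · rw [← h1, Nat.unpair_pair] at h2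
      exact absurd h2 (h _)

theorem rangeGraph_maximal_antichain {p : ℕ → ℕ} {A : Set ℕ}
    (hA : Maximal (rangeGraph p).Antichain A) (n k : ℕ) :
    (Nat.pair (Nat.pair n k) 0 ∈ A ∧ Nat.pair (Nat.pair n k) 1 ∈ A) ↔
      ∀ j, p (Nat.pair n j) ≠ k := by
  constructor
  · rintro ⟨h0, h1⟩ j hj
    refine hA.1.2 _ h0 _ h1 (fun e => ?_) (rangeGraph_reachable hj)
    exact zero_ne_one (Nat.pair_eq_pair.1 e).2
  · intro h
    have key : ∀ i < 2, Nat.pair (Nat.pair n k) i ∈ A := fun i hi => by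
      refine hA.2 (y := insert (Nat.pair (Nat.pair n k) i) A) ⟨?_, ?_⟩ (Set.subset_insert _ _)
        (Set.mem_insert _ _)
      · exact Set.insert_subset (Or.inl (by simpa using hi)) hA.1.1
      · rintro u (rfl | hu) v (rfl | hv) huv hr
        · exact huv rfl
        · exact huv (rangeGraph_isolated h hi hr).symm
        · exact huv (rangeGraph_isolated h hi hr.symm)
        · exact hA.1.2 u hu v hv huv hr
    exact ⟨key 0 (by norm_num), key 1 (by norm_num)⟩

theorem CountableGraph.CodedBy.eq {G G' : CountableGraph} {p : ℕ → ℕ} (h : G.CodedBy p)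
    (h' : G'.CodedBy p) : G = G' := by
  have h1 : G.verts = G'.verts := charFun_injective (h.1.symm.trans h'.1)
  have h2 : G.graph = G'.graph := by
    ext u v
    rw [← h.adj_iff, h'.adj_iff]
  cases G
  cases G'
  simp_all

theorem parallelization_closedChoice_reducible_GAC :
    StrongReducible (parallelization closedChoice) GAC := by
  classical
  have hV : OracleDecidable IsRangeVertex := by
    refine .or (.lt (.unpair₂ .id) (.const 2)) (.eq (.oracle (.natPair
      (.unpair₁ (.unpair₁ .id)) ?_)) (.unpair₂ (.unpair₁ .id)))
    exact .primrec₂ Primrec.nat_sub (.unpair₂ .id) (.const 2)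
  have hE : OracleDecidable fun p (m : ℕ) => (rangeGraph p).graph.Adj m.unpair.1 m.unpair.2 := by
    have hu : OracleComputable fun _ (n : ℕ) => n.unpair.1 := .unpair₁ .id
    have hv : OracleComputable fun _ (n : ℕ) => n.unpair.2 := .unpair₂ .id
    exact .and (.and (.eq (.unpair₁ hu) (.unpair₁ hv)) (.not (.eq hu hv)))
      (.and (.and (hV.comp hu) (hV.comp hv)) (.or (.lt (.const 1) (.unpair₂ hu))
        (.lt (.const 1) (.unpair₂ hv))))
  have hΦ : OracleComputable fun p (n : ℕ) => if n.unpair.1 = 0 then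
      if IsRangeVertex p n.unpair.2 then 1 else 0
      else if (rangeGraph p).graph.Adj n.unpair.2.unpair.1 n.unpair.2.unpair.2 then 1 else 0 :=
    .ite (.eq (.unpair₁ .id) (.const 0))
      (.ite (hV.comp (.unpair₂ .id)) (.const 1) (.const 0))
      (.ite (hE.comp (.unpair₂ .id)) (.const 1) (.const 0))
  have hP : OracleDecidable fun r (x : ℕ × ℕ) => r (Nat.pair (Nat.pair x.1 x.2) 0) = 1 ∧
      r (Nat.pair (Nat.pair x.1 x.2) 1) = 1 :=
    .and (.eq (.oracle (.natPair (.of_primrec Primrec₂.natPair) (.const 0))) (.const 1))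
      (.eq (.oracle (.natPair (.of_primrec Primrec₂.natPair) (.const 1))) (.const 1))
  obtain ⟨Ψ, hΨ, hΨs⟩ := hP.exists_search (G := fun _ x => x.2) (.of_primrec .snd)
  refine ⟨_, Ψ, OracleComputable.nat_iff.1 hΦ, hΨ, fun p ⟨t, ht⟩ => ?_⟩
  set q : ℕ → ℕ := fun n => if n.unpair.1 = 0 then
      if IsRangeVertex p n.unpair.2 then 1 else 0
      else if (rangeGraph p).graph.Adj n.unpair.2.unpair.1 n.unpair.2.unpair.2 then 1 else 0 with hq
  have hcode : (rangeGraph p).CodedBy q := by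
    constructor <;> funext n
    · simp [hq, column, charFun, Set.indicator, rangeGraph]
      congr
    · simp [hq, column, charFun, Set.indicator]
  rw [mem_parallelization_closedChoice] at ht
  refine ⟨q, fun n => Part.mem_some _, ⟨_, _, _, hcode, rfl,
    (rangeGraph p).maximal_antichain_least⟩, fun r ⟨G, A, hG, hr, hA⟩ => ?_⟩
  obtain rfl := hG.eq hcode
  have hr' : r = charFun A := hr
  obtain ⟨s, hs, hs'⟩ := hΨs r fun n => ⟨t n, by
    simp only [hr', charFun_eq_one]
    exact (rangeGraph_maximal_antichain hA _ _).2 (ht n)⟩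
  refine ⟨s, hs, mem_parallelization_closedChoice.2 fun n => ?_⟩
  obtain ⟨w, ⟨hw, -⟩, hsw⟩ := hs' n
  simp only [hr', charFun_eq_one] at hw
  rw [hsw]
  exact (rangeGraph_maximal_antichain hA _ _).1 hw

/-! ### Bases of vector spaces -/

namespace CountableVectorSpace

/-- The value of the linear combination given by a list of pairs (scalar, vector), computed from a
code of the vector space. -/
def combination (p : ℕ → ℕ) (l : List (ℕ × ℕ)) : ℕ :=
  l.foldl (fun s x => p (Nat.pair 4 (Nat.pair s (p (Nat.pair 5 (Nat.pair x.1 x.2))))))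
    (p (Nat.pair 6 2))

variable {V V' : CountableVectorSpace} {p : ℕ → ℕ}

theorem CodedBy.combination_eq (h : V.CodedBy p) (l : List (V.scalars × V.vectors)) :
    combination p (l.map fun x => ((x.1 : ℕ), (x.2 : ℕ))) =
      ((l.map fun x => x.1 • x.2).sum : V.vectors) := by
  obtain ⟨-, -, -, -, hadd, hsmul, -, -, hzero⟩ := h
  induction l using List.reverseRecOn with
  | nil => simpa [combination, column] using hzero
  | append_singleton l x ih =>
    simp only [column] at hadd hsmul
    simp only [combination] at ih
    simp [combination, ih, hadd, hsmul]

theorem mem_span_iff_exists_list (S : Set V.vectors) (v : V.vectors) :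
    v ∈ Submodule.span V.scalars S ↔ ∃ l : List (V.scalars × V.vectors),
      (∀ x ∈ l, x.2 ∈ S) ∧ (l.map fun x => x.1 • x.2).sum = v := by
  constructor
  · intro h
    induction h using Submodule.span_induction with
    | mem x hx => exact ⟨[(1, x)], by simpa using hx, by simp⟩
    | zero => exact ⟨[], by simp, by simp⟩
    | add x y _ _ hx hy =>
      obtain ⟨l, hl, rfl⟩ := hx
      obtain ⟨l', hl', rfl⟩ := hy
      refine ⟨l ++ l', fun z hz => ?_, by simp⟩
      exact (List.mem_append.1 hz).elim (hl z) (hl' z)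
    | smul a x _ hx =>
      obtain ⟨l, hl, rfl⟩ := hx
      refine ⟨l.map fun x => (a * x.1, x.2), fun z hz => ?_, ?_⟩
      · obtain ⟨y, hy, rfl⟩ := List.mem_map.1 hz
        exact hl y hy
      · simp [List.smul_sum, Function.comp_def, mul_smul]
  · rintro ⟨l, hl, rfl⟩
    refine list_sum_mem fun y hy => ?_
    obtain ⟨x, hx, rfl⟩ := List.mem_map.1 hy
    exact Submodule.smul_mem _ _ (Submodule.subset_span (hl x hx))

theorem CodedBy.mem_span_iff (h : V.CodedBy p) (v : V.vectors) :
    v ∈ Submodule.span V.scalars {u : V.vectors | (u : ℕ) < v} ↔ ∃ l : List (ℕ × ℕ),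
      (∀ y ∈ l, (p (Nat.pair 0 y.1) = 1 ∧ p (Nat.pair 3 y.2) = 1) ∧ y.2 < v) ∧
        combination p l = v := by
  have e0 : ∀ n, p (Nat.pair 0 n) = charFun V.scalars n := fun n => congrFun h.1 n
  have e3 : ∀ n, p (Nat.pair 3 n) = charFun V.vectors n := fun n => congrFun h.2.2.2.1 n
  simp only [e0, e3, charFun_eq_one]
  rw [mem_span_iff_exists_list]
  constructor
  · rintro ⟨l, hl, hs⟩
    refine ⟨_, fun y hy => ?_, (h.combination_eq l).trans (congrArg _ hs)⟩
    obtain ⟨x, hx, rfl⟩ := List.mem_map.1 hy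
    exact ⟨⟨x.1.2, x.2.2⟩, hl x hx⟩
  · rintro ⟨l, hl, hs⟩
    have hr : l ∈ Set.range (List.map fun x : V.scalars × V.vectors => ((x.1 : ℕ), (x.2 : ℕ))) := by
      rw [Set.range_list_map]
      exact fun y hy => ⟨(⟨y.1, (hl y hy).1.1⟩, ⟨y.2, (hl y hy).1.2⟩), rfl⟩
    obtain ⟨l, rfl⟩ := hr
    refine ⟨l, fun x hx => (hl _ (List.mem_map_of_mem hx)).2, Subtype.ext ?_⟩
    rw [← h.combination_eq, hs]

/-- The vectors that are not in the span of the vectors with smaller codes form a basis. -/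
theorem isBasis_greedy (V : CountableVectorSpace) :
    V.IsBasis {v | v ∉ Submodule.span V.scalars {u : V.vectors | (u : ℕ) < v}} := by
  constructor
  · refine linearIndepOn_of_finite _ fun t ht hfin => ?_
    obtain ⟨t, rfl⟩ := hfin.exists_finset_coe
    induction t using Finset.induction_on_max with
    | empty => simp
    | insert a s ha ih =>
      rw [Finset.coe_insert] at ht ⊢
      refine (ih ((Set.subset_insert _ _).trans ht) s.finite_toSet).id_insert ?_
      exact fun h => ht (Set.mem_insert _ _) (Submodule.span_mono (fun u hu => ha u hu) h)
  · rw [eq_top_iff]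
    suffices ∀ (n : ℕ) (v : V.vectors), (v : ℕ) = n → v ∈ Submodule.span V.scalars
        {v : V.vectors | v ∉ Submodule.span V.scalars {u : V.vectors | (u : ℕ) < v}} from
      fun v _ => this _ v rfl
    intro n
    induction n using Nat.strong_induction_on with
    | _ n ih =>
      rintro v rfl
      by_cases h : v ∈ Submodule.span V.scalars {u : V.vectors | (u : ℕ) < v}
      · have hle : Submodule.span V.scalars {u : V.vectors | (u : ℕ) < v} ≤ Submodule.span V.scalars
            {v : V.vectors | v ∉ Submodule.span V.scalars {u : V.vectors | (u : ℕ) < v}} :=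
          Submodule.span_le.2 fun u hu => ih u hu u rfl
        exact hle h
      · exact Submodule.subset_span h

/-- Independence and span do not depend on the choice of the bundled structures. -/
theorem isBasis_transfer {S T : Type*} (s s' : Semiring S) (a a' : AddCommMonoid T)
    (m : @Module S T s a) (m' : @Module S T s' a') (hs : s = s') (ha : a = a')
    (hm : ∀ (x : S) (y : T), m.smul x y = m'.smul x y) (B : Set T)
    (hB : @LinearIndepOn T S T id s a m B ∧ @Submodule.span S T s a m B = ⊤) :
    @LinearIndepOn T S T id s' a' m' B ∧ @Submodule.span S T s' a' m' B = ⊤ := by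
  subst hs ha
  obtain rfl : m = m' := Module.ext' _ _ hm
  exact hB

/-- A code determines the vector space. -/
theorem CodedBy.exists_isBasis (h : V.CodedBy p) (h' : V'.CodedBy p) {B : Set V.vectors}
    (hB : V.IsBasis B) :
    Nonempty (V.scalars ≃+* V'.scalars) ∧
    ∃ B' : Set V'.vectors, Subtype.val '' B' = Subtype.val '' B ∧ V'.IsBasis B' := by
  rcases V with @⟨S, T, F, A, M⟩
  rcases V' with @⟨S', T', F', A', M'⟩
  obtain ⟨h0, h1, h2, h3, h4, h5, -⟩ := h
  obtain ⟨h0', h1', h2', h3', h4', h5', -⟩ := h'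
  obtain rfl : S = S' := charFun_injective (h0.symm.trans h0')
  obtain rfl : T = T' := charFun_injective (h3.symm.trans h3')
  have hadd : ∀ a b : S, F.add a b = F'.add a b := fun a b =>
    Subtype.ext ((h1 a b).symm.trans (h1' a b))
  have hmul : ∀ a b : S, F.mul a b = F'.mul a b := fun a b =>
    Subtype.ext ((h2 a b).symm.trans (h2' a b))
  have hvadd : ∀ a b : T, A.add a b = A'.add a b := fun a b =>
    Subtype.ext ((h4 a b).symm.trans (h4' a b))
  have hsmul : ∀ (a : S) (b : T), M.smul a b = M'.smul a b := fun a b =>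
    Subtype.ext ((h5 a b).symm.trans (h5' a b))
  refine ⟨⟨@RingEquiv.mk S S F.toMul F'.toMul F.toAdd F'.toAdd (Equiv.refl _) hmul hadd⟩,
    B, rfl, ?_⟩
  refine isBasis_transfer _ _ _ _ M M' ?_ ?_ hsmul B hB
  · exact Semiring.ext (funext fun a => funext fun b => hadd a b)
      (funext fun a => funext fun b => hmul a b)
  · have : A = A' := AddCommGroup.ext (funext fun a => funext fun b => hvadd a b)
    rw [this]

end CountableVectorSpace

theorem VSBRat_reducible_VSB : StrongReducible VSBRat VSB := by
  have hid : ComputableFunctional fun p n => Part.some (p n) := .oracle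
  refine ⟨_, _, hid, hid, fun p ⟨t, V, B, ⟨e⟩, hV, ht, hB⟩ =>
    ⟨p, fun n => Part.mem_some _, ⟨t, V, B, hV, ht, hB⟩, fun r ⟨V', B', hV', hr, hB'⟩ =>
    ⟨r, fun n => Part.mem_some _, V', B', ?_, hV', hr, hB'⟩⟩⟩
  obtain ⟨⟨e'⟩, -⟩ := hV'.exists_isBasis hV hB'
  exact ⟨e'.trans e⟩

theorem VSB_reducible_parallelization_closedChoice :
    StrongReducible VSB (parallelization closedChoice) := by
  let l : ℕ → List (ℕ × ℕ) := Denumerable.ofNat (List (ℕ × ℕ))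
  have hcomb : OracleComputable fun p (x : ℕ × ℕ) =>
      CountableVectorSpace.combination p (l x.2) := by
    refine .list_foldl (α := ℕ × ℕ) (β := ℕ × ℕ) (H := fun p x =>
      p (Nat.pair 4 (Nat.pair x.2.1 (p (Nat.pair 5 (Nat.pair x.2.2.1 x.2.2.2))))))
      (.of_primrec (.comp (.ofNat _) .snd)) (.oracle (.const _)) ?_
    refine .oracle (.natPair (.const 4) (.natPair (.of_primrec (.comp .fst .snd)) (.oracle
      (.natPair (.const 5) (.natPair (.of_primrec ?_) (.of_primrec ?_))))))
    · exact .comp .fst (.comp .snd .snd)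
    · exact .comp .snd (.comp .snd .snd)
  have hsmall : OracleDecidable fun p (x : ℕ × ℕ) => ∀ y ∈ l x.2,
      (p (Nat.pair 0 y.1) = 1 ∧ p (Nat.pair 3 y.2) = 1) ∧ y.2 < x.1 := by
    refine .forall_mem (α := ℕ × ℕ) (β := ℕ × ℕ) (P := fun p x =>
      (p (Nat.pair 0 x.2.1) = 1 ∧ p (Nat.pair 3 x.2.2) = 1) ∧ x.2.2 < x.1.1)
      (.and (.and ?_ ?_) ?_) (.of_primrec (.comp (.ofNat _) .snd))
    · exact .eq (.oracle (.natPair (.const 0) (.of_primrec (.comp .fst .snd)))) (.const 1)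
    · exact .eq (.oracle (.natPair (.const 3) (.of_primrec (.comp .snd .snd)))) (.const 1)
    · exact .lt (.of_primrec (.comp .snd .snd)) (.of_primrec (.comp .fst .fst))
  refine reducible_of_coenumerable_solution (R := fun p x => p (Nat.pair 3 x.1) ≠ 1 ∨
    ((∀ y ∈ l x.2, (p (Nat.pair 0 y.1) = 1 ∧ p (Nat.pair 3 y.2) = 1) ∧ y.2 < x.1) ∧
      CountableVectorSpace.combination p (l x.2) = x.1))
    (.or (.not (.eq (.oracle (.natPair (.const 3) (.of_primrec .fst))) (.const 1)))
      (.and hsmall (.eq hcomb (.of_primrec .fst)))) ?_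
  rintro p ⟨t, V, C, hV, -, -⟩
  refine ⟨V, _, hV, congrArg charFun ?_, V.isBasis_greedy⟩
  have e3 : ∀ n, p (Nat.pair 3 n) = charFun V.vectors n := fun n => congrFun hV.2.2.2.1 n
  ext v
  simp only [e3, ne_eq, charFun_eq_one, not_or, not_not, Set.mem_image,
    Set.mem_ofPred_eq, Subtype.exists, exists_and_right, exists_eq_right, forall_and, forall_const,
    hV.mem_span_iff]
  constructor
  · rintro ⟨hv, h⟩
    exact ⟨hv, fun ⟨m, hm⟩ => h (encode m) (by simpa only [l, Denumerable.ofNat_encode] using hm)⟩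
  · rintro ⟨hv, h⟩
    exact ⟨hv, fun k hk => h ⟨_, hk⟩⟩

/-! ### Codes of rational numbers -/

/-- The rational number coded by `(a, (b, c))` is `(a - b) / (c + 1)`. -/
def ratVal (n : ℕ) : ℚ :=
  ((n.unpair.1 : ℚ) - n.unpair.2.unpair.1) / (n.unpair.2.unpair.2 + 1)

/-- A code of the natural number `s`. -/
def ratNat (s : ℕ) : ℕ := Nat.pair s (Nat.pair 0 0)

/-- A code of the sum: cross-multiplication. -/
def ratAdd (n m : ℕ) : ℕ :=
  Nat.pair (n.unpair.1 * (m.unpair.2.unpair.2 + 1) + m.unpair.1 * (n.unpair.2.unpair.2 + 1))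
    (Nat.pair (n.unpair.2.unpair.1 * (m.unpair.2.unpair.2 + 1) +
        m.unpair.2.unpair.1 * (n.unpair.2.unpair.2 + 1))
      ((n.unpair.2.unpair.2 + 1) * (m.unpair.2.unpair.2 + 1) - 1))

/-- A code of the product. -/
def ratMul (n m : ℕ) : ℕ :=
  Nat.pair (n.unpair.1 * m.unpair.1 + n.unpair.2.unpair.1 * m.unpair.2.unpair.1)
    (Nat.pair (n.unpair.1 * m.unpair.2.unpair.1 + n.unpair.2.unpair.1 * m.unpair.1)
      ((n.unpair.2.unpair.2 + 1) * (m.unpair.2.unpair.2 + 1) - 1))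

/-- Equality of the coded rational numbers, expressed by natural numbers. -/
def RatEq (n m : ℕ) : Prop :=
  n.unpair.1 * (m.unpair.2.unpair.2 + 1) + m.unpair.2.unpair.1 * (n.unpair.2.unpair.2 + 1) =
    m.unpair.1 * (n.unpair.2.unpair.2 + 1) + n.unpair.2.unpair.1 * (m.unpair.2.unpair.2 + 1)

theorem ratVal_pair (a b c : ℕ) :
    ratVal (Nat.pair a (Nat.pair b c)) = ((a : ℚ) - b) / (c + 1) := by
  simp [ratVal]

theorem ratVal_ratNat (s : ℕ) : ratVal (ratNat s) = s := by
  simp [ratNat, ratVal_pair]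

theorem ratVal_zero : ratVal 0 = 0 := by
  simp [ratVal]

theorem cast_succ_mul_succ_sub_one (c d : ℕ) :
    (((c + 1) * (d + 1) - 1 : ℕ) : ℚ) + 1 = ((c : ℚ) + 1) * (d + 1) := by
  rw [← Nat.cast_succ, Nat.succ_eq_add_one, Nat.sub_add_cancel (Nat.succ_le_of_lt (by positivity))]
  push_cast
  ring

theorem ratVal_ratAdd (n m : ℕ) : ratVal (ratAdd n m) = ratVal n + ratVal m := by
  rw [ratAdd, ratVal_pair, cast_succ_mul_succ_sub_one, ratVal, ratVal]
  push_cast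
  field_simp
  ring

theorem ratVal_ratMul (n m : ℕ) : ratVal (ratMul n m) = ratVal n * ratVal m := by
  rw [ratMul, ratVal_pair, cast_succ_mul_succ_sub_one, ratVal, ratVal]
  push_cast
  field_simp
  ring

theorem ratEq_iff {n m : ℕ} : RatEq n m ↔ ratVal n = ratVal m := by
  rw [RatEq, ratVal, ratVal, div_eq_div_iff (by positivity) (by positivity), ← @Nat.cast_inj ℚ]
  push_cast
  constructor <;> intro h <;> linear_combination h

theorem ratVal_surjective : Function.Surjective ratVal := by
  intro q
  refine ⟨Nat.pair q.num.toNat (Nat.pair (-q.num).toNat (q.den - 1)), ?_⟩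
  have h1 : ((q.num.toNat : ℚ) - (-q.num).toNat) = q.num := by
    exact_mod_cast Int.toNat_sub_toNat_neg q.num
  have h2 : ((q.den - 1 : ℕ) : ℚ) + 1 = q.den := by
    exact_mod_cast Nat.sub_add_cancel q.den_pos
  rw [ratVal_pair, h1, h2, Rat.num_div_den]

theorem abs_ratVal_le (n : ℕ) : |ratVal n| ≤ n := by
  have h1 : (n.unpair.1 : ℚ) ≤ n := by exact_mod_cast Nat.unpair_left_le n
  have h2 : (n.unpair.2.unpair.1 : ℚ) ≤ n := by
    exact_mod_cast (Nat.unpair_left_le _).trans (Nat.unpair_right_le n)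
  rw [ratVal, abs_div, div_le_iff₀ (by positivity), abs_of_pos (by positivity :
    (0 : ℚ) < n.unpair.2.unpair.2 + 1)]
  have h3 : |(n.unpair.1 : ℚ) - n.unpair.2.unpair.1| ≤ n := by
    rw [abs_le]
    have := Nat.cast_nonneg (α := ℚ) n.unpair.1
    have := Nat.cast_nonneg (α := ℚ) n.unpair.2.unpair.1
    constructor <;> linarith
  have : (0 : ℚ) ≤ n * n.unpair.2.unpair.2 := by positivity
  linarith

/-- Distinct rational numbers differ by at least the product of their inverse denominators. -/
theorem one_le_abs_ratVal_sub {n m : ℕ} (h : ratVal n ≠ ratVal m) :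
    1 ≤ |ratVal n - ratVal m| * ((n + 1) * (m + 1)) := by
  set c : ℕ := n.unpair.2.unpair.2 with hc
  set d : ℕ := m.unpair.2.unpair.2 with hd
  have hcn : (c : ℚ) ≤ n := by
    exact_mod_cast (Nat.unpair_right_le _).trans (Nat.unpair_right_le n)
  have hdm : (d : ℚ) ≤ m := by
    exact_mod_cast (Nat.unpair_right_le _).trans (Nat.unpair_right_le m)
  have hpos : (0 : ℚ) < (c + 1) * (d + 1) := by positivity
  have hint : ∃ z : ℤ, (ratVal n - ratVal m) * ((c + 1) * (d + 1)) = z := by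
    refine ⟨((n.unpair.1 : ℤ) - n.unpair.2.unpair.1) * (d + 1) -
      ((m.unpair.1 : ℤ) - m.unpair.2.unpair.1) * (c + 1), ?_⟩
    rw [ratVal, ratVal, ← hc, ← hd]
    push_cast
    field_simp
  obtain ⟨z, hz⟩ := hint
  have hz0 : z ≠ 0 := by
    rintro rfl
    exact (mul_ne_zero (sub_ne_zero.2 h) hpos.ne') (by simpa using hz)
  have h1 : (1 : ℚ) ≤ |ratVal n - ratVal m| * ((c + 1) * (d + 1)) := by
    rw [← abs_of_pos hpos, ← abs_mul, hz]
    exact_mod_cast Int.one_le_abs hz0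
  refine h1.trans (mul_le_mul_of_nonneg_left ?_ (abs_nonneg _))
  gcongr

section

open Primrec

theorem primrec_ratNat : Primrec ratNat := Primrec₂.natPair.comp .id (.const _)

theorem primrec₂_ratAdd : Primrec₂ ratAdd := by
  have a1 : Primrec fun x : ℕ × ℕ => x.1.unpair.1 := .comp fst (.comp .unpair fst)
  have b1 : Primrec fun x : ℕ × ℕ => x.1.unpair.2.unpair.1 :=
    .comp fst (.comp .unpair (.comp snd (.comp .unpair fst)))
  have c1 : Primrec fun x : ℕ × ℕ => x.1.unpair.2.unpair.2 + 1 :=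
    .comp succ (.comp snd (.comp .unpair (.comp snd (.comp .unpair fst))))
  have a2 : Primrec fun x : ℕ × ℕ => x.2.unpair.1 := .comp fst (.comp .unpair snd)
  have b2 : Primrec fun x : ℕ × ℕ => x.2.unpair.2.unpair.1 :=
    .comp fst (.comp .unpair (.comp snd (.comp .unpair snd)))
  have c2 : Primrec fun x : ℕ × ℕ => x.2.unpair.2.unpair.2 + 1 :=
    .comp succ (.comp snd (.comp .unpair (.comp snd (.comp .unpair snd))))
  exact Primrec₂.natPair.comp (nat_add.comp (nat_mul.comp a1 c2) (nat_mul.comp a2 c1))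
    (Primrec₂.natPair.comp (nat_add.comp (nat_mul.comp b1 c2) (nat_mul.comp b2 c1))
      (nat_sub.comp (nat_mul.comp c1 c2) (.const 1)))

theorem primrec₂_ratMul : Primrec₂ ratMul := by
  have a1 : Primrec fun x : ℕ × ℕ => x.1.unpair.1 := .comp fst (.comp .unpair fst)
  have b1 : Primrec fun x : ℕ × ℕ => x.1.unpair.2.unpair.1 :=
    .comp fst (.comp .unpair (.comp snd (.comp .unpair fst)))
  have c1 : Primrec fun x : ℕ × ℕ => x.1.unpair.2.unpair.2 + 1 :=
    .comp succ (.comp snd (.comp .unpair (.comp snd (.comp .unpair fst))))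
  have a2 : Primrec fun x : ℕ × ℕ => x.2.unpair.1 := .comp fst (.comp .unpair snd)
  have b2 : Primrec fun x : ℕ × ℕ => x.2.unpair.2.unpair.1 :=
    .comp fst (.comp .unpair (.comp snd (.comp .unpair snd)))
  have c2 : Primrec fun x : ℕ × ℕ => x.2.unpair.2.unpair.2 + 1 :=
    .comp succ (.comp snd (.comp .unpair (.comp snd (.comp .unpair snd))))
  exact Primrec₂.natPair.comp (nat_add.comp (nat_mul.comp a1 a2) (nat_mul.comp b1 b2))
    (Primrec₂.natPair.comp (nat_add.comp (nat_mul.comp a1 b2) (nat_mul.comp b1 a2))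
      (nat_sub.comp (nat_mul.comp c1 c2) (.const 1)))

end

theorem OracleDecidable.ratEq {α : Type*} [Primcodable α] {F G : (ℕ → ℕ) → α → ℕ}
    (hF : OracleComputable F) (hG : OracleComputable G) :
    OracleDecidable fun p a => RatEq (F p a) (G p a) := by
  have hmul {F G : (ℕ → ℕ) → α → ℕ} (hF : OracleComputable F) (hG : OracleComputable G) :
      OracleComputable fun p a => F p a * (G p a).unpair.2.unpair.2.succ :=
    .primrec₂ Primrec.nat_mul hF (.primrec .succ (.unpair₂ (.unpair₂ hG)))
  exact .eq
    (.primrec₂ Primrec.nat_add (hmul (.unpair₁ hF) hG) (hmul (.unpair₁ (.unpair₂ hG)) hF))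
    (.primrec₂ Primrec.nat_add (hmul (.unpair₁ hG) hF) (hmul (.unpair₁ (.unpair₂ hF)) hG))

/-! ### A space of rational vectors with coded collapses -/

/-- The sequence of blocks in `ℚ × ℚ` coded by a list; it vanishes beyond the length of the list. -/
def vecVal (l : List (ℕ × ℕ)) (m : ℕ) : ℚ × ℚ := (ratVal (l.getI m).1, ratVal (l.getI m).2)

/-- A list coding the sum. -/
def vecAdd (l l' : List (ℕ × ℕ)) : List (ℕ × ℕ) :=
  (List.range (l.length + l'.length)).map fun m =>
    (ratAdd (l.getI m).1 (l'.getI m).1, ratAdd (l.getI m).2 (l'.getI m).2)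

/-- A list coding the multiple by the rational number with code `a`. -/
def vecSMul (a : ℕ) (l : List (ℕ × ℕ)) : List (ℕ × ℕ) :=
  l.map fun x => (ratMul a x.1, ratMul a x.2)

/-- The list whose only nonzero block is `x`, at position `m`. -/
def vecSingle (m : ℕ) (x : ℕ × ℕ) : List (ℕ × ℕ) :=
  (List.range (m + 1)).map fun i => if i = m then x else (0, 0)

theorem vecVal_of_length_le {l : List (ℕ × ℕ)} {m : ℕ} (h : l.length ≤ m) : vecVal l m = 0 := by
  rw [vecVal, List.getI_eq_default _ h]
  exact Prod.ext ratVal_zero ratVal_zero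

theorem vecVal_nil : vecVal [] = 0 := funext fun _ => vecVal_of_length_le (by simp)

theorem vecVal_vecAdd (l l' : List (ℕ × ℕ)) : vecVal (vecAdd l l') = vecVal l + vecVal l' := by
  funext m
  by_cases h : m < l.length + l'.length
  · have : (vecAdd l l').getI m =
        (ratAdd (l.getI m).1 (l'.getI m).1, ratAdd (l.getI m).2 (l'.getI m).2) := by
      rw [List.getI_eq_getElem _ (by simpa [vecAdd] using h)]
      simp [vecAdd]
    simp [vecVal, this, ratVal_ratAdd]
  · rw [Pi.add_apply, vecVal_of_length_le, vecVal_of_length_le, vecVal_of_length_le, add_zero]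
    · omega
    · omega
    · simp [vecAdd]; omega

theorem vecVal_vecSMul (a : ℕ) (l : List (ℕ × ℕ)) :
    vecVal (vecSMul a l) = ratVal a • vecVal l := by
  funext m
  by_cases h : m < l.length
  · have : (vecSMul a l).getI m = (ratMul a (l.getI m).1, ratMul a (l.getI m).2) := by
      rw [List.getI_eq_getElem _ (by simpa [vecSMul] using h), List.getI_eq_getElem _ h]
      simp [vecSMul]
    simp [vecVal, this, ratVal_ratMul]
  · rw [Pi.smul_apply, vecVal_of_length_le, vecVal_of_length_le, smul_zero]
    · omega
    · simp [vecSMul]; omega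

theorem vecVal_vecSingle (m : ℕ) (x : ℕ × ℕ) :
    vecVal (vecSingle m x) = Pi.single m (ratVal x.1, ratVal x.2) := by
  funext i
  by_cases h : i < m + 1
  · have : (vecSingle m x).getI i = if i = m then x else (0, 0) := by
      rw [List.getI_eq_getElem _ (by simpa [vecSingle] using h)]
      simp [vecSingle]
    rw [vecVal, this]
    by_cases e : i = m
    · subst e; simp
    · simp [e, ratVal_zero]
  · rw [vecVal_of_length_le (by simp [vecSingle]; omega), Pi.single_eq_of_ne (by omega)]

/-- The `n`-th function of the sequence `p` takes the value `k` at `s` for the first time, where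
`m` codes the pair `(n, k)`. -/
def FirstHit (p : ℕ → ℕ) (m s : ℕ) : Prop :=
  p (Nat.pair m.unpair.1 s) = m.unpair.2 ∧ ∀ i < s, p (Nat.pair m.unpair.1 i) ≠ m.unpair.2

theorem FirstHit.unique {p : ℕ → ℕ} {m s t : ℕ} (h : FirstHit p m s) (h' : FirstHit p m t) :
    s = t := by
  rcases lt_trichotomy s t with hlt | rfl | hlt
  · exact absurd h.1 (h'.2 s hlt)
  · rfl
  · exact absurd h'.1 (h.2 t hlt)

theorem exists_firstHit {p : ℕ → ℕ} {n k j : ℕ} (h : p (Nat.pair n j) = k) :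
    ∃ s, FirstHit p (Nat.pair n k) s := by
  classical
  have hex : ∃ s, p (Nat.pair n s) = k := ⟨j, h⟩
  refine ⟨Nat.find hex, ?_, fun i hi => ?_⟩
  · simpa using Nat.find_spec hex
  · simpa using Nat.find_min hex hi

open Classical in
/-- The quotient map that imposes on the block `m` with basis `a`, `b` the relation `b = s • a` if
`FirstHit p m s`. Its kernel is decidable relative to `p` since the coefficient `s` of the
relation can be read off from a vector, although it is not decidable whether there is a relation. -/
noncomputable def collapse (p : ℕ → ℕ) : (ℕ → ℚ × ℚ) →ₗ[ℚ] (ℕ → ℚ × ℚ) :=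
  LinearMap.pi fun m =>
    (if h : ∃ s, FirstHit p m s then
      (LinearMap.fst ℚ ℚ ℚ + (h.choose : ℚ) • LinearMap.snd ℚ ℚ ℚ).prod 0
    else LinearMap.id) ∘ₗ LinearMap.proj m

theorem collapse_of_firstHit {p : ℕ → ℕ} {m s : ℕ} (h : FirstHit p m s) (v : ℕ → ℚ × ℚ) :
    collapse p v m = ((v m).1 + s * (v m).2, 0) := by
  have hex : ∃ s, FirstHit p m s := ⟨s, h⟩
  have e : hex.choose = s := hex.choose_spec.unique h
  simp [collapse, hex, e]

theorem collapse_of_not_firstHit {p : ℕ → ℕ} {m : ℕ} (h : ¬ ∃ s, FirstHit p m s)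
    (v : ℕ → ℚ × ℚ) : collapse p v m = v m := by
  simp [collapse, h]

theorem collapse_apply_eq_zero {p : ℕ → ℕ} {m : ℕ} {v : ℕ → ℚ × ℚ} (h : v m = 0) :
    collapse p v m = 0 := by
  by_cases hex : ∃ s, FirstHit p m s
  · rw [collapse_of_firstHit hex.choose_spec, h]
    simp
  · rw [collapse_of_not_firstHit hex, h]

/-- Equality of two coded blocks after the collapse. Distinct blocks that are identified determine
`s`, and the bound on `s` makes this decidable relative to `p`. -/
def BlockEq (p : ℕ → ℕ) (m : ℕ) (x y : ℕ × ℕ) : Prop :=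
  (RatEq x.1 y.1 ∧ RatEq x.2 y.2) ∨
    ∃ s < (x.1 + y.1) * ((x.2 + 1) * (y.2 + 1)) + 1, FirstHit p m s ∧
      RatEq (ratAdd x.1 (ratMul (ratNat s) x.2)) (ratAdd y.1 (ratMul (ratNat s) y.2))

/-- Equality of two coded vectors after the collapse. -/
def VecEq (p : ℕ → ℕ) (l l' : List (ℕ × ℕ)) : Prop :=
  ∀ m < l.length + l'.length, BlockEq p m (l.getI m) (l'.getI m)

theorem blockEq_iff {p : ℕ → ℕ} {m : ℕ} {l l' : List (ℕ × ℕ)} :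
    BlockEq p m (l.getI m) (l'.getI m) ↔
      collapse p (vecVal l) m = collapse p (vecVal l') m := by
  simp only [BlockEq, ratEq_iff, ratVal_ratAdd, ratVal_ratMul, ratVal_ratNat]
  by_cases hex : ∃ s, FirstHit p m s
  · obtain ⟨s, hs⟩ := hex
    rw [collapse_of_firstHit hs, collapse_of_firstHit hs]
    simp only [vecVal, Prod.mk.injEq, and_true]
    constructor
    · rintro (⟨h1, h2⟩ | ⟨t, -, ht, h⟩)
      · rw [h1, h2]
      · rwa [hs.unique ht]
    · intro h
      by_cases h2 : ratVal (l.getI m).2 = ratVal (l'.getI m).2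
      · exact Or.inl ⟨by rw [h2] at h; exact add_right_cancel h, h2⟩
      -- the relation determines `s`, which bounds it
      refine Or.inr ⟨s, Nat.lt_succ_of_le ?_, hs, h⟩
      have e : (s : ℚ) * |ratVal (l.getI m).2 - ratVal (l'.getI m).2| =
          |ratVal (l'.getI m).1 - ratVal (l.getI m).1| := by
        rw [← abs_of_nonneg (Nat.cast_nonneg (α := ℚ) s), ← abs_mul]
        congr 1
        linear_combination h
      have h3 := one_le_abs_ratVal_sub h2
      have h4 : |ratVal (l'.getI m).1 - ratVal (l.getI m).1| ≤ (l.getI m).1 + (l'.getI m).1 :=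
        (abs_sub _ _).trans (by linarith [abs_ratVal_le (l.getI m).1, abs_ratVal_le (l'.getI m).1])
      rw [← e] at h4
      have h5 : (s : ℚ) ≤ ((l.getI m).1 + (l'.getI m).1) *
          (((l.getI m).2 + 1) * ((l'.getI m).2 + 1)) := by
        calc (s : ℚ) = s * 1 := (mul_one _).symm
          _ ≤ s * (|ratVal (l.getI m).2 - ratVal (l'.getI m).2| *
              (((l.getI m).2 + 1) * ((l'.getI m).2 + 1))) := by gcongr
          _ = s * |ratVal (l.getI m).2 - ratVal (l'.getI m).2| *
              (((l.getI m).2 + 1) * ((l'.getI m).2 + 1)) := by ring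
          _ ≤ _ := by gcongr
      exact_mod_cast h5
  · rw [collapse_of_not_firstHit hex, collapse_of_not_firstHit hex]
    have : ∀ s, ¬ FirstHit p m s := fun s hs => hex ⟨s, hs⟩
    simp [this, vecVal]

theorem vecEq_iff {p : ℕ → ℕ} {l l' : List (ℕ × ℕ)} :
    VecEq p l l' ↔ collapse p (vecVal l) = collapse p (vecVal l') := by
  simp only [VecEq, blockEq_iff]
  refine ⟨fun h => funext fun m => ?_, fun h m _ => congrFun h m⟩
  by_cases hm : m < l.length + l'.length
  · exact h m hm
  · rw [collapse_apply_eq_zero (vecVal_of_length_le (by omega)),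
      collapse_apply_eq_zero (vecVal_of_length_le (by omega))]

section

open Primrec

theorem primrec₂_vecAdd : Primrec₂ vecAdd := by
  have h1 : Primrec fun x : (List (ℕ × ℕ) × List (ℕ × ℕ)) × ℕ => x.1.1.getI x.2 :=
    list_getI.comp (.comp fst fst) snd
  have h2 : Primrec fun x : (List (ℕ × ℕ) × List (ℕ × ℕ)) × ℕ => x.1.2.getI x.2 :=
    list_getI.comp (.comp snd fst) snd
  exact list_map (list_range.comp (nat_add.comp (list_length.comp fst) (list_length.comp snd)))
    (Primrec.pair (primrec₂_ratAdd.comp (.comp fst h1) (.comp fst h2))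
      (primrec₂_ratAdd.comp (.comp snd h1) (.comp snd h2)))

theorem primrec₂_vecSMul : Primrec₂ vecSMul :=
  list_map snd (Primrec.pair (primrec₂_ratMul.comp (.comp fst fst) (.comp fst snd))
    (primrec₂_ratMul.comp (.comp fst fst) (.comp snd snd)))

theorem primrec₂_vecSingle : Primrec₂ vecSingle :=
  list_map (list_range.comp (.comp succ fst))
    (.ite (Primrec.eq.comp snd (.comp fst fst)) (.comp snd fst) (.const _))

end

theorem oracleDecidable_firstHit : OracleDecidable fun p (x : ℕ × ℕ) => FirstHit p x.1 x.2 := by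
  refine .and (.eq (.oracle (.natPair (.unpair₁ (.of_primrec .fst)) (.of_primrec .snd)))
    (.unpair₂ (.of_primrec .fst))) (.forall_lt (α := ℕ × ℕ)
    (P := fun p y => p (Nat.pair y.1.1.unpair.1 y.2) ≠ y.1.1.unpair.2) (.not (.eq
      (.oracle (.natPair (.unpair₁ (.of_primrec ?_)) (.of_primrec .snd)))
      (.unpair₂ (.of_primrec ?_)))) (.of_primrec .snd)) <;> exact .comp .fst .fst

theorem oracleDecidable_blockEq :
    OracleDecidable fun p (x : ℕ × (ℕ × ℕ) × (ℕ × ℕ)) => BlockEq p x.1 x.2.1 x.2.2 := by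
  have hx : Primrec fun x : ℕ × (ℕ × ℕ) × (ℕ × ℕ) => x.2.1 := .comp .fst .snd
  have hy : Primrec fun x : ℕ × (ℕ × ℕ) × (ℕ × ℕ) => x.2.2 := .comp .snd .snd
  have hx1 := Primrec.fst.comp hx
  have hx2 := Primrec.snd.comp hx
  have hy1 := Primrec.fst.comp hy
  have hy2 := Primrec.snd.comp hy
  refine .or (.and (.ratEq (.of_primrec hx1) (.of_primrec hy1))
    (.ratEq (.of_primrec hx2) (.of_primrec hy2)))
    (.exists_lt (α := ℕ × (ℕ × ℕ) × (ℕ × ℕ)) (P := fun p z => FirstHit p z.1.1 z.2 ∧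
      RatEq (ratAdd z.1.2.1.1 (ratMul (ratNat z.2) z.1.2.1.2))
        (ratAdd z.1.2.2.1 (ratMul (ratNat z.2) z.1.2.2.2)))
    (.and (oracleDecidable_firstHit.comp 
      (F := fun _ (z : (ℕ × (ℕ × ℕ) × (ℕ × ℕ)) × ℕ) => (z.1.1, z.2)) ?_)
      (.ratEq (.of_primrec ?_) (.of_primrec ?_))) (.of_primrec ?_))
  · exact .of_primrec (.pair (.comp .fst .fst) .snd)
  · exact primrec₂_ratAdd.comp (hx1.comp .fst) (primrec₂_ratMul.comp
      (primrec_ratNat.comp .snd) (hx2.comp .fst))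
  · exact primrec₂_ratAdd.comp (hy1.comp .fst) (primrec₂_ratMul.comp
      (primrec_ratNat.comp .snd) (hy2.comp .fst))
  · exact Primrec.succ.comp (Primrec.nat_mul.comp (Primrec.nat_add.comp hx1 hy1)
      (Primrec.nat_mul.comp (Primrec.succ.comp hx2) (Primrec.succ.comp hy2)))

theorem oracleDecidable_vecEq :
    OracleDecidable fun p (x : List (ℕ × ℕ) × List (ℕ × ℕ)) => VecEq p x.1 x.2 := by
  have h1 : Primrec fun y : (List (ℕ × ℕ) × List (ℕ × ℕ)) × ℕ => y.1.1.getI y.2 :=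
    Primrec.list_getI.comp (.comp .fst .fst) .snd
  have h2 : Primrec fun y : (List (ℕ × ℕ) × List (ℕ × ℕ)) × ℕ => y.1.2.getI y.2 :=
    Primrec.list_getI.comp (.comp .snd .fst) .snd
  have hb : OracleDecidable fun p (y : (List (ℕ × ℕ) × List (ℕ × ℕ)) × ℕ) =>
      BlockEq p y.2 (y.1.1.getI y.2) (y.1.2.getI y.2) :=
    oracleDecidable_blockEq.comp (.of_primrec (Primrec.snd.pair (h1.pair h2)))
  have hl : Primrec fun x : List (ℕ × ℕ) × List (ℕ × ℕ) => x.1.length + x.2.length :=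
    Primrec.nat_add.comp (Primrec.list_length.comp .fst) (Primrec.list_length.comp .snd)
  exact hb.forall_lt (.of_primrec hl)

/-- The rational vector space of all collapsed vectors. -/
noncomputable def collapseSpace (p : ℕ → ℕ) : Submodule ℚ (ℕ → ℚ × ℚ) where
  carrier := Set.range fun l => collapse p (vecVal l)
  zero_mem' := ⟨[], by simp [vecVal_nil]⟩
  add_mem' := by
    rintro _ _ ⟨l, rfl⟩ ⟨l', rfl⟩
    exact ⟨vecAdd l l', by simp [vecVal_vecAdd]⟩
  smul_mem' := by
    rintro q _ ⟨l, rfl⟩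
    obtain ⟨a, rfl⟩ := ratVal_surjective q
    exact ⟨vecSMul a l, by simp [vecVal_vecSMul]⟩

/-- The element of the collapsed space coded by a list. -/
noncomputable def vecClass (p : ℕ → ℕ) (l : List (ℕ × ℕ)) : collapseSpace p :=
  ⟨collapse p (vecVal l), l, rfl⟩

section VecClass

variable {p : ℕ → ℕ}

theorem vecClass_nil : vecClass p [] = 0 := Subtype.ext (by simp [vecClass, vecVal_nil])

theorem vecClass_vecAdd (l l' : List (ℕ × ℕ)) :
    vecClass p (vecAdd l l') = vecClass p l + vecClass p l' :=
  Subtype.ext (by simp [vecClass, vecVal_vecAdd])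

theorem vecClass_vecSMul (a : ℕ) (l : List (ℕ × ℕ)) :
    vecClass p (vecSMul a l) = ratVal a • vecClass p l :=
  Subtype.ext (by simp [vecClass, vecVal_vecSMul])

theorem vecEq_iff_vecClass_eq {l l' : List (ℕ × ℕ)} :
    VecEq p l l' ↔ vecClass p l = vecClass p l' := by
  rw [vecEq_iff]
  exact ⟨fun h => Subtype.ext h, fun h => congrArg Subtype.val h⟩

theorem vecClass_ofNat_surjective :
    Function.Surjective fun n => vecClass p (Denumerable.ofNat (List (ℕ × ℕ)) n) := by
  rintro ⟨_, l, rfl⟩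
  exact ⟨encode l, by simp [vecClass]⟩

end VecClass

open Classical in
/-- The least code of an element, with respect to a coding by all natural numbers. -/
noncomputable def leastCode {X : Type*} {val : ℕ → X} (h : Function.Surjective val) (x : X) : ℕ :=
  Nat.find (h x)

theorem val_leastCode {X : Type*} {val : ℕ → X} (h : Function.Surjective val) (x : X) :
    val (leastCode h x) = x := by
  classical exact Nat.find_spec (h x)

theorem val_ne_of_lt_leastCode {X : Type*} {val : ℕ → X} (h : Function.Surjective val) (x : X)
    {n : ℕ} (hn : n < leastCode h x) : val n ≠ x := by
  classical exact Nat.find_min (h x) hn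

/-- The least code of a rational number. -/
noncomputable def ratCode : ℚ → ℕ := leastCode ratVal_surjective

theorem ratVal_ratCode (q : ℚ) : ratVal (ratCode q) = q := val_leastCode _ q

theorem oracleComputable_ratCode : OracleComputable fun _ n => ratCode (ratVal n) := by
  refine .find (P := fun _ x => RatEq x.2 x.1)
    (.ratEq (.of_primrec .snd) (.of_primrec .fst)) fun _ n => ⟨?_, fun v hv => ?_⟩
  · rw [ratEq_iff, ratVal_ratCode]
  · rw [ratEq_iff]
    exact val_ne_of_lt_leastCode _ _ hv

/-- The code of a vector: its least code as the class of a list, together with an initial segment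
of `p`. The latter makes it possible to recover `p` from any unbounded set of vectors. -/
noncomputable def vecCode (p : ℕ → ℕ) (x : collapseSpace p) : ℕ :=
  Nat.pair (leastCode vecClass_ofNat_surjective x)
    (encode ((List.range (leastCode vecClass_ofNat_surjective x)).map p))

/-- The list that represents the vector with code `w`. -/
def codeList (w : ℕ) : List (ℕ × ℕ) := Denumerable.ofNat _ w.unpair.1

theorem primrec_codeList : Primrec codeList :=
  (Primrec.ofNat (List (ℕ × ℕ))).comp (Primrec.fst.comp .unpair)

theorem vecClass_codeList_vecCode {p : ℕ → ℕ} (x : collapseSpace p) :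
    vecClass p (codeList (vecCode p x)) = x := by
  rw [codeList, vecCode, Nat.unpair_pair]
  exact val_leastCode vecClass_ofNat_surjective x

theorem oracleComputable_map_range : OracleComputable fun p n => (List.range n).map p := by
  have hp : OracleComputable fun p (x : ℕ × ℕ × List ℕ) => p x.2.1 :=
    .oracle (.of_primrec (.comp .fst .snd))
  have hH : OracleComputable fun p (x : ℕ × ℕ × List ℕ) => x.2.2 ++ [p x.2.1] :=
    .primrec₂ (g := fun (l : List ℕ) (a : ℕ) => l ++ [a]) Primrec.list_concat
      (.of_primrec (.comp .snd .snd)) hp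
  refine (OracleComputable.nat_rec .id (.const []) hH).of_eq fun p n => ?_
  induction n with
  | zero => rfl
  | succ n ih =>
    simp only [ih, List.range_succ, List.map_append, List.map_cons, List.map_nil]

theorem oracleComputable_vecCode : OracleComputable fun p l => vecCode p (vecClass p l) := by
  have h : OracleComputable fun p n => leastCode vecClass_ofNat_surjective
      (vecClass p (Denumerable.ofNat (List (ℕ × ℕ)) n)) := by
    refine .find (P := fun p x => VecEq p (Denumerable.ofNat _ x.2) (Denumerable.ofNat _ x.1))
      (oracleDecidable_vecEq.comp (F := fun _ (x : ℕ × ℕ) => (Denumerable.ofNat _ x.2,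
        Denumerable.ofNat _ x.1)) (.of_primrec (.pair (.comp (.ofNat _) .snd)
        (.comp (.ofNat _) .fst)))) fun p n => ⟨?_, fun v hv => ?_⟩
    · rw [vecEq_iff_vecClass_eq]
      exact val_leastCode vecClass_ofNat_surjective _
    · rw [vecEq_iff_vecClass_eq]
      exact val_ne_of_lt_leastCode vecClass_ofNat_surjective _ hv
  have h' : OracleComputable fun p l => leastCode vecClass_ofNat_surjective (vecClass p l) :=
    (h.comp (.of_primrec .encode)).of_eq fun p l => by simp
  exact .natPair h' (.primrec .encode (oracleComputable_map_range.comp h'))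

theorem ratCode_injective : Function.Injective ratCode :=
  Function.LeftInverse.injective ratVal_ratCode

theorem vecCode_injective (p : ℕ → ℕ) : Function.Injective (vecCode p) :=
  Function.LeftInverse.injective (g := fun w => vecClass p (codeList w)) vecClass_codeList_vecCode

/-- The coded rational numbers. -/
noncomputable def ratCodeEquiv : Set.range ratCode ≃ ℚ :=
  (Equiv.ofInjective _ ratCode_injective).symm

/-- The coded vectors. -/
noncomputable def vecCodeEquiv (p : ℕ → ℕ) : Set.range (vecCode p) ≃ collapseSpace p :=
  (Equiv.ofInjective _ (vecCode_injective p)).symm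

/-- The collapsed space as a space of natural numbers, with the structure transported along the
codes. -/
noncomputable def collapseVectorSpace (p : ℕ → ℕ) : CountableVectorSpace :=
  letI : Field (Set.range ratCode) := ratCodeEquiv.field
  letI : AddCommGroup (Set.range (vecCode p)) := (vecCodeEquiv p).addCommGroup
  letI : Module ℚ (Set.range (vecCode p)) := (vecCodeEquiv p).module ℚ
  { scalars := Set.range ratCode
    vectors := Set.range (vecCode p)
    module := Module.compHom _ (ratCodeEquiv.ringEquiv : Set.range ratCode →+* ℚ) }

section CollapseVectorSpace

variable {p : ℕ → ℕ}

/-- The scalars are the rational numbers. -/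
noncomputable def scalarEquiv (p : ℕ → ℕ) : (collapseVectorSpace p).scalars ≃+* ℚ :=
  letI : Field (Set.range ratCode) := ratCodeEquiv.field
  ratCodeEquiv.ringEquiv

/-- The vectors are the elements of the collapsed space. -/
noncomputable def vectorEquiv (p : ℕ → ℕ) : (collapseVectorSpace p).vectors ≃+ collapseSpace p :=
  letI : AddCommGroup (Set.range (vecCode p)) := (vecCodeEquiv p).addCommGroup
  (vecCodeEquiv p).addEquiv

theorem vectorEquiv_smul (a : (collapseVectorSpace p).scalars)
    (v : (collapseVectorSpace p).vectors) :
    vectorEquiv p (a • v) = scalarEquiv p a • vectorEquiv p v :=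
  (vecCodeEquiv p).apply_symm_apply _

theorem coe_scalar (a : (collapseVectorSpace p).scalars) : (a : ℕ) = ratCode (scalarEquiv p a) :=
  congrArg Subtype.val (ratCodeEquiv.symm_apply_apply a).symm

theorem coe_vector (v : (collapseVectorSpace p).vectors) :
    (v : ℕ) = vecCode p (vectorEquiv p v) :=
  congrArg Subtype.val ((vecCodeEquiv p).symm_apply_apply v).symm

theorem ratVal_coe_scalar (a : (collapseVectorSpace p).scalars) :
    ratVal a = scalarEquiv p a := by
  rw [coe_scalar, ratVal_ratCode]

theorem vecClass_codeList_coe_vector (v : (collapseVectorSpace p).vectors) :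
    vecClass p (codeList v) = vectorEquiv p v := by
  rw [coe_vector, vecClass_codeList_vecCode]

end CollapseVectorSpace

open Classical in
/-- The code of the collapsed space, with the columns in the order of
`CountableVectorSpace.CodedBy`; operations are computed on representatives and normalized. -/
noncomputable def collapseCode (p : ℕ → ℕ) (n : ℕ) : ℕ :=
  let i := n.unpair.1
  let x := n.unpair.2.unpair.1
  let y := n.unpair.2.unpair.2
  if i = 0 then if ratCode (ratVal n.unpair.2) = n.unpair.2 then 1 else 0
  else if i = 1 then ratCode (ratVal (ratAdd x y))
  else if i = 2 then ratCode (ratVal (ratMul x y))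
  else if i = 3 then if vecCode p (vecClass p (codeList n.unpair.2)) = n.unpair.2 then 1 else 0
  else if i = 4 then vecCode p (vecClass p (vecAdd (codeList x) (codeList y)))
  else if i = 5 then vecCode p (vecClass p (vecSMul x (codeList y)))
  else if n.unpair.2 = 0 then ratCode (ratVal 0)
  else if n.unpair.2 = 1 then ratCode (ratVal (ratNat 1))
  else vecCode p (vecClass p [])

theorem oracleComputable_collapseCode : OracleComputable collapseCode := by
  have hi : OracleComputable fun _ (n : ℕ) => n.unpair.1 := .unpair₁ .id
  have hz : OracleComputable fun _ (n : ℕ) => n.unpair.2 := .unpair₂ .id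
  have hx : OracleComputable fun _ (n : ℕ) => n.unpair.2.unpair.1 := .unpair₁ hz
  have hy : OracleComputable fun _ (n : ℕ) => n.unpair.2.unpair.2 := .unpair₂ hz
  refine .ite (.eq hi (.const _)) (.ite (.eq (oracleComputable_ratCode.comp hz) hz)
    (.const _) (.const _)) ?_
  refine .ite (.eq hi (.const _)) (oracleComputable_ratCode.comp (.primrec₂ primrec₂_ratAdd hx hy))
    ?_
  refine .ite (.eq hi (.const _)) (oracleComputable_ratCode.comp (.primrec₂ primrec₂_ratMul hx hy))
    ?_
  refine .ite (.eq hi (.const _)) (.ite (.eq (oracleComputable_vecCode.comp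
    (.primrec primrec_codeList hz)) hz) (.const _) (.const _)) ?_
  refine .ite (.eq hi (.const _)) (oracleComputable_vecCode.comp (.primrec₂ primrec₂_vecAdd
    (.primrec primrec_codeList hx) (.primrec primrec_codeList hy))) ?_
  refine .ite (.eq hi (.const _)) (oracleComputable_vecCode.comp (.primrec₂ primrec₂_vecSMul hx
    (.primrec primrec_codeList hy))) ?_
  exact .ite (.eq hz (.const _)) (.const _) (.ite (.eq hz (.const _)) (.const _)
    (oracleComputable_vecCode.comp (.const [])))

theorem collapseVectorSpace_codedBy (p : ℕ → ℕ) :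
    (collapseVectorSpace p).CodedBy (collapseCode p) := by
  have h0 : ∀ n, n ∈ (collapseVectorSpace p).scalars ↔ ratCode (ratVal n) = n := fun n =>
    ⟨by rintro ⟨q, rfl⟩; rw [ratVal_ratCode], fun h => ⟨_, h⟩⟩
  have h3 : ∀ n, n ∈ (collapseVectorSpace p).vectors ↔ vecCode p (vecClass p (codeList n)) = n :=
    fun n => ⟨by rintro ⟨q, rfl⟩; rw [vecClass_codeList_vecCode], fun h => ⟨_, h⟩⟩
  refine ⟨funext fun n => ?_, fun a b => ?_, fun a b => ?_, funext fun n => ?_, fun a b => ?_,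
    fun a b => ?_, ?_, ?_, ?_⟩ <;> simp only [column, collapseCode, Nat.unpair_pair]
  · simp [charFun, Set.indicator, h0]
  · simp [coe_scalar (a + b), ratVal_ratAdd, ratVal_coe_scalar]
  · simp [coe_scalar (a * b), ratVal_ratMul, ratVal_coe_scalar]
  · simp [charFun, Set.indicator, h3]
  · simp [coe_vector (a + b), vecClass_vecAdd, vecClass_codeList_coe_vector]
  · simp [coe_vector (a • b), vecClass_vecSMul, vecClass_codeList_coe_vector, ratVal_coe_scalar,
      vectorEquiv_smul]
  · simp [coe_scalar (0 : (collapseVectorSpace p).scalars), ratVal_zero]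
  · simp [coe_scalar (1 : (collapseVectorSpace p).scalars), ratVal_ratNat]
  · simp [coe_vector (0 : (collapseVectorSpace p).vectors), vecClass_nil]

/-! ### Linear combinations of basis vectors with integer coefficients -/

section Certificates

variable {K M : Type*} [Field K] [AddCommGroup M] [Module K M]

/-- Every vector in the rational span of `B` has a multiple that is a difference of sums of elements
of `B`. -/
theorem exists_multiple_add_sum_eq_sum (e : K ≃+* ℚ) {B : Set M} {x : M}
    (hx : x ∈ Submodule.span K B) :
    ∃ (D : ℕ) (L₁ L₂ : List M), (∀ y ∈ L₁, y ∈ B) ∧ (∀ y ∈ L₂, y ∈ B) ∧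
      (D + 1) • x + L₁.sum = L₂.sum := by
  suffices ∃ D : ℕ, ∃ s ∈ AddSubmonoid.closure B, ∃ t ∈ AddSubmonoid.closure B,
      (D + 1) • x + s = t by
    obtain ⟨D, s, hs, t, ht, h⟩ := this
    obtain ⟨L₁, h1, rfl⟩ := AddSubmonoid.exists_list_of_mem_closure hs
    obtain ⟨L₂, h2, rfl⟩ := AddSubmonoid.exists_list_of_mem_closure ht
    exact ⟨D, L₁, L₂, h1, h2, h⟩
  induction hx using Submodule.span_induction with
  | mem x hx => exact ⟨0, 0, zero_mem _, x, AddSubmonoid.subset_closure hx, by simp⟩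
  | zero => exact ⟨0, 0, zero_mem _, 0, zero_mem _, by simp⟩
  | add x y _ _ hx hy =>
    obtain ⟨D, s, hs, t, ht, h⟩ := hx
    obtain ⟨D', s', hs', t', ht', h'⟩ := hy
    refine ⟨D * D' + D + D', (D' + 1) • s + (D + 1) • s', add_mem (nsmul_mem hs _)
      (nsmul_mem hs' _), (D' + 1) • t + (D + 1) • t', add_mem (nsmul_mem ht _)
      (nsmul_mem ht' _), ?_⟩
    rw [← h, ← h']
    module
  | smul a x _ hx =>
    obtain ⟨D, s, hs, t, ht, h⟩ := hx
    obtain ⟨d, hd⟩ : ∃ d, (e a).den = d + 1 := ⟨(e a).den - 1, by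
      have := (e a).den_pos; omega⟩
    have ha : (d + 1) • (a • x) = (e a).num • x := by
      have h1 : ((d + 1 : ℕ) : K) * a = ((e a).num : K) := by
        apply e.injective
        rw [map_mul, map_natCast, map_intCast, ← hd, mul_comm]
        exact Rat.mul_den_eq_num _
      rw [← Nat.cast_smul_eq_nsmul K, smul_smul, h1, Int.cast_smul_eq_zsmul]
    obtain ⟨n, hn | hn⟩ := (e a).num.eq_nat_or_neg
    · refine ⟨D * d + D + d, n • s, nsmul_mem hs _, n • t, nsmul_mem ht _, ?_⟩
      rw [hn, natCast_zsmul] at ha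
      rw [← h, show D * d + D + d + 1 = (D + 1) * (d + 1) by ring, mul_smul, ha]
      module
    · refine ⟨D * d + D + d, n • t, nsmul_mem ht _, n • s, nsmul_mem hs _, ?_⟩
      rw [hn, neg_smul, natCast_zsmul] at ha
      rw [← h, show D * d + D + d + 1 = (D + 1) * (d + 1) by ring, mul_smul, ha]
      module

/-- Integral expressions of `a` and `s • a` in a basis bound `s`: compare the coordinates at a basis
vector where `a` has a nonzero coordinate. -/
theorem le_of_multiple_add_sum_eq_sum (e : K ≃+* ℚ) {B : Set M} (hB : LinearIndepOn K id B)
    (hspan : Submodule.span K B = ⊤) {a : M} (ha : a ≠ 0) {s D D' : ℕ} {L₁ L₂ L₃ L₄ : List M}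
    (h1 : ∀ y ∈ L₁, y ∈ B) (h2 : ∀ y ∈ L₂, y ∈ B) (h3 : ∀ y ∈ L₃, y ∈ B) (h4 : ∀ y ∈ L₄, y ∈ B)
    (e1 : (D + 1) • a + L₁.sum = L₂.sum) (e2 : (D' + 1) • s • a + L₃.sum = L₄.sum) :
    s ≤ (D + 1) * (L₃.length + L₄.length) := by
  let b : Module.Basis B K M := Module.Basis.mk hB (by simp [hspan])
  obtain ⟨c, hc⟩ : ∃ c, b.repr a c ≠ 0 := by
    by_contra! h
    exact ha (b.repr.map_eq_zero_iff.1 (Finsupp.ext h))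
  let χ : M →+ ℚ := (e : K →+* ℚ).toAddMonoidHom.comp (b.coord c).toAddMonoidHom
  have hχa : χ a ≠ 0 := fun h => hc (by simpa [χ] using h)
  have hχB : ∀ y ∈ B, ∃ n : ℕ, n ≤ 1 ∧ χ y = n := by
    intro y hy
    have : b.repr y = Finsupp.single ⟨y, hy⟩ 1 := by
      have hb : b ⟨y, hy⟩ = y := by simp [b]
      rw [← b.repr_self, hb]
    by_cases hyc : (⟨y, hy⟩ : B) = c
    · exact ⟨1, le_rfl, by simp [χ, this, hyc]⟩
    · exact ⟨0, zero_le_one, by simp [χ, this, hyc]⟩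
  have hχ : ∀ L : List M, (∀ y ∈ L, y ∈ B) → ∃ n : ℕ, n ≤ L.length ∧ χ L.sum = n := by
    intro L hL
    induction L with
    | nil => exact ⟨0, le_rfl, by simp⟩
    | cons y L ih =>
      obtain ⟨n, hn, hn'⟩ := ih fun z hz => hL z (List.mem_cons_of_mem _ hz)
      obtain ⟨m, hm, hm'⟩ := hχB y (hL y List.mem_cons_self)
      exact ⟨m + n, by simp; omega, by simp [hn', hm']⟩
  obtain ⟨n1, -, x1⟩ := hχ L₁ h1
  obtain ⟨n2, -, x2⟩ := hχ L₂ h2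
  obtain ⟨n3, l3, x3⟩ := hχ L₃ h3
  obtain ⟨n4, l4, x4⟩ := hχ L₄ h4
  have f1 := congrArg χ e1
  have f2 := congrArg χ e2
  simp only [map_add, map_nsmul, x1, x2, x3, x4, nsmul_eq_mul] at f1 f2
  have g1 : ((D + 1 : ℕ) : ℚ) * χ a = ((n2 - n1 : ℤ) : ℚ) := by push_cast at f1 ⊢; linarith
  have hne : (n2 - n1 : ℤ) ≠ 0 := by
    intro h
    rw [h, Int.cast_zero] at g1
    exact mul_ne_zero (Nat.cast_ne_zero.2 (Nat.succ_ne_zero D)) hχa g1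
  have g2 : (D' + 1 : ℤ) * s * (n2 - n1) = (D + 1) * (n4 - n3) := by
    have : ((D' + 1 : ℤ) * s * (n2 - n1) : ℚ) = (D + 1) * (n4 - n3) := by
      push_cast at f1 f2 g1 ⊢
      linear_combination (-(D' + 1) * s : ℚ) * g1 + (D + 1 : ℚ) * f2
    exact_mod_cast this
  have g3 := congrArg abs g2
  rw [abs_mul, abs_mul (D + 1 : ℤ), abs_of_nonneg (by positivity : (0 : ℤ) ≤ (D' + 1) * s),
    abs_of_nonneg (by positivity : (0 : ℤ) ≤ D + 1)] at g3
  have g4 : |(n4 - n3 : ℤ)| ≤ L₃.length + L₄.length := by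
    rw [abs_le]
    constructor <;> push_cast [← Int.ofNat_le] at * <;> omega
  have g5 : 1 ≤ |(n2 - n1 : ℤ)| := Int.one_le_abs hne
  have : (s : ℤ) ≤ (D + 1) * (L₃.length + L₄.length) := by
    calc (s : ℤ) ≤ (D' + 1) * s := by nlinarith [Int.natCast_nonneg s, Int.natCast_nonneg D']
      _ ≤ (D' + 1) * s * |(n2 - n1 : ℤ)| := le_mul_of_one_le_right (by positivity) g5
      _ = (D + 1) * |(n4 - n3 : ℤ)| := g3
      _ ≤ _ := by gcongr
  exact_mod_cast this

end Certificates

/-! ### Closed choice from rational vector spaces -/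

/-- The sum of the vectors with the codes in a list. -/
def codeSum (L : List ℕ) : List (ℕ × ℕ) := L.foldr (fun w s => vecAdd (codeList w) s) []

/-- The triple `(D, L₁, L₂)` expresses `D + 1` times the vector coded by `l` as a difference of sums
of vectors in the set with characteristic function `r`. -/
def IsCertificate (p r : ℕ → ℕ) (l : List (ℕ × ℕ)) (c : ℕ × List ℕ × List ℕ) : Prop :=
  ((∀ w ∈ c.2.1, r w = 1) ∧ ∀ w ∈ c.2.2, r w = 1) ∧
    VecEq p (vecAdd (vecSMul (ratNat (c.1 + 1)) l) (codeSum c.2.1)) (codeSum c.2.2)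

section Space

variable {p : ℕ → ℕ}

theorem vecClass_codeSum (L : List (collapseVectorSpace p).vectors) :
    vecClass p (codeSum (L.map Subtype.val)) = vectorEquiv p L.sum := by
  induction L with
  | nil => simp [codeSum, vecClass_nil]
  | cons v L ih =>
    rw [List.sum_cons, map_add, ← ih, ← vecClass_codeList_coe_vector, ← vecClass_vecAdd]
    rfl

/-- The vector coded by a list, as an element of the transported space. -/
noncomputable def listVector (p : ℕ → ℕ) (l : List (ℕ × ℕ)) : (collapseVectorSpace p).vectors :=
  (vectorEquiv p).symm (vecClass p l)

theorem isCertificate_iff {B : Set (collapseVectorSpace p).vectors} {l : List (ℕ × ℕ)}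
    {c : ℕ × List ℕ × List ℕ} :
    IsCertificate p (charFun (Subtype.val '' B)) l c ↔
      ∃ L₁ L₂ : List (collapseVectorSpace p).vectors, (∀ y ∈ L₁, y ∈ B) ∧ (∀ y ∈ L₂, y ∈ B) ∧
        (c.1 + 1) • listVector p l + L₁.sum = L₂.sum ∧
        c.2.1 = L₁.map Subtype.val ∧ c.2.2 = L₂.map Subtype.val := by
  have hlist : ∀ L : List ℕ, (∀ w ∈ L, charFun (Subtype.val '' B) w = 1) ↔
      ∃ L' : List (collapseVectorSpace p).vectors, (∀ y ∈ L', y ∈ B) ∧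
        L = L'.map Subtype.val := by
    intro L
    simp only [charFun_eq_one]
    constructor
    · intro h
      induction L with
      | nil => exact ⟨[], by simp, rfl⟩
      | cons w L ih =>
        obtain ⟨L', h1, rfl⟩ := ih fun y hy => h y (List.mem_cons_of_mem _ hy)
        obtain ⟨v, hv, rfl⟩ := h w List.mem_cons_self
        exact ⟨v :: L', List.forall_mem_cons.2 ⟨hv, h1⟩, rfl⟩
    · rintro ⟨L', h1, rfl⟩ w hw
      obtain ⟨v, hv, rfl⟩ := List.mem_map.1 hw
      exact ⟨v, h1 v hv, rfl⟩
  have hval : ∀ L₁ L₂ : List (collapseVectorSpace p).vectors,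
      VecEq p (vecAdd (vecSMul (ratNat (c.1 + 1)) l) (codeSum (L₁.map Subtype.val)))
        (codeSum (L₂.map Subtype.val)) ↔ (c.1 + 1) • listVector p l + L₁.sum = L₂.sum := by
    intro L₁ L₂
    rw [vecEq_iff_vecClass_eq, vecClass_vecAdd, vecClass_vecSMul, vecClass_codeSum,
      vecClass_codeSum, ratVal_ratNat, Nat.cast_smul_eq_nsmul, ← (vectorEquiv p).injective.eq_iff,
      map_add, map_nsmul, listVector, AddEquiv.apply_symm_apply]
  rw [IsCertificate, hlist, hlist]
  constructor
  · rintro ⟨⟨⟨L₁, h1, e1⟩, L₂, h2, e2⟩, h⟩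
    rw [e1, e2, hval] at h
    exact ⟨L₁, L₂, h1, h2, h, e1, e2⟩
  · rintro ⟨L₁, L₂, h1, h2, h, e1, e2⟩
    refine ⟨⟨⟨L₁, h1, e1⟩, L₂, h2, e2⟩, ?_⟩
    rwa [e1, e2, hval]

theorem exists_isCertificate {B : Set (collapseVectorSpace p).vectors}
    (hB : (collapseVectorSpace p).IsBasis B) (l : List (ℕ × ℕ)) :
    ∃ c, IsCertificate p (charFun (Subtype.val '' B)) l c := by
  obtain ⟨D, L₁, L₂, h1, h2, h⟩ := exists_multiple_add_sum_eq_sum (scalarEquiv p)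
    (hB.2 ▸ Submodule.mem_top : listVector p l ∈ Submodule.span _ B)
  exact ⟨(D, L₁.map Subtype.val, L₂.map Subtype.val),
    isCertificate_iff.2 ⟨L₁, L₂, h1, h2, h, rfl, rfl⟩⟩

/-- A code of the first generator `a` of the block `m`. -/
def blockFst (m : ℕ) : List (ℕ × ℕ) := vecSingle m (ratNat 1, 0)

/-- A code of the second generator `b` of the block `m`. -/
def blockSnd (m : ℕ) : List (ℕ × ℕ) := vecSingle m (0, ratNat 1)

theorem vecVal_blockFst (m : ℕ) : vecVal (blockFst m) = Pi.single m (1, 0) := by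
  rw [blockFst, vecVal_vecSingle, ratVal_ratNat, ratVal_zero, Nat.cast_one]

theorem vecVal_blockSnd (m : ℕ) : vecVal (blockSnd m) = Pi.single m (0, 1) := by
  rw [blockSnd, vecVal_vecSingle, ratVal_ratNat, ratVal_zero, Nat.cast_one]

theorem collapse_blockFst_ne_zero (m : ℕ) : collapse p (vecVal (blockFst m)) m ≠ 0 := by
  rw [vecVal_blockFst]
  by_cases h : ∃ s, FirstHit p m s
  · obtain ⟨s, hs⟩ := h
    simp [collapse_of_firstHit hs]
  · simp [collapse_of_not_firstHit h]

theorem listVector_blockFst_ne_zero (m : ℕ) : listVector p (blockFst m) ≠ 0 := by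
  rw [listVector, ne_eq, EmbeddingLike.map_eq_zero_iff]
  exact fun h => collapse_blockFst_ne_zero m (congrFun (congrArg Subtype.val h) m)

theorem listVector_blockSnd {m s : ℕ} (h : FirstHit p m s) :
    listVector p (blockSnd m) = s • listVector p (blockFst m) := by
  rw [listVector, listVector, ← map_nsmul]
  congr 1
  refine Subtype.ext (funext fun i => ?_)
  change collapse p (vecVal (blockSnd m)) i = (s • collapse p (vecVal (blockFst m))) i
  rw [vecVal_blockFst, vecVal_blockSnd, ← map_nsmul]
  by_cases hi : i = m
  · subst hi
    simp [collapse_of_firstHit h]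
  · rw [collapse_apply_eq_zero (by simp [hi]), collapse_apply_eq_zero (by simp [hi])]

/-- A basis contains vectors with arbitrarily large list codes, since vectors with small list codes
vanish at all large positions. -/
theorem exists_mem_basis_gt {B : Set (collapseVectorSpace p).vectors}
    (hB : (collapseVectorSpace p).IsBasis B) (z : ℕ) :
    ∃ v ∈ B, z < (v : ℕ).unpair.1 := by
  by_contra! h
  let m : ℕ := (Finset.range (z + 1)).sup fun n => (Denumerable.ofNat (List (ℕ × ℕ)) n).length
  have key : ∀ v ∈ Submodule.span (collapseVectorSpace p).scalars B,
      (vectorEquiv p v : ℕ → ℚ × ℚ) m = 0 := by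
    intro v hv
    induction hv using Submodule.span_induction with
    | mem v hv =>
      rw [← vecClass_codeList_coe_vector]
      refine collapse_apply_eq_zero (vecVal_of_length_le ?_)
      exact Finset.le_sup (f := fun n => (Denumerable.ofNat (List (ℕ × ℕ)) n).length)
        (Finset.mem_range_succ_iff.2 (h v hv))
    | zero => simp
    | add x y _ _ hx hy => simp [hx, hy]
    | smul a x _ hx => simp [vectorEquiv_smul, hx]
  refine collapse_blockFst_ne_zero (p := p) m ?_
  have := key (listVector p (blockFst m)) (hB.2 ▸ Submodule.mem_top)
  rwa [listVector, AddEquiv.apply_symm_apply] at this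

/-- If the block `m` is collapsed at `s`, certificates for its two generators bound `s`. -/
theorem FirstHit.le_of_isCertificate {B : Set (collapseVectorSpace p).vectors}
    (hB : (collapseVectorSpace p).IsBasis B) {m s : ℕ} (hs : FirstHit p m s)
    {c d : ℕ × List ℕ × List ℕ}
    (hc : IsCertificate p (charFun (Subtype.val '' B)) (blockFst m) c)
    (hd : IsCertificate p (charFun (Subtype.val '' B)) (blockSnd m) d) :
    s ≤ (c.1 + 1) * (d.2.1.length + d.2.2.length) := by
  obtain ⟨L₁, L₂, h1, h2, e, -, -⟩ := isCertificate_iff.1 hc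
  obtain ⟨L₃, L₄, h3, h4, e', l3, l4⟩ := isCertificate_iff.1 hd
  rw [listVector_blockSnd hs] at e'
  rw [l3, l4, List.length_map, List.length_map]
  exact le_of_multiple_add_sum_eq_sum (scalarEquiv p) hB.1 hB.2 (listVector_blockFst_ne_zero m)
    h1 h2 h3 h4 e e'

end Space

theorem OracleComputable.subst {α σ : Type*} [Primcodable α] [Primcodable σ]
    {F : (ℕ → ℕ) → α → σ} {E : (ℕ → ℕ) → ℕ → ℕ} (hF : OracleComputable F)
    (hE : OracleComputable E) : OracleComputable fun t a => F (E t) a := by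
  obtain ⟨F', hF', h⟩ := ComputableFunctional.subst hF (OracleComputable.nat_iff.1 hE)
  refine hF'.of_eq fun t n => ?_
  rw [h t (E t) fun n => Part.mem_some _]

theorem OracleDecidable.subst {α : Type*} [Primcodable α] {P : (ℕ → ℕ) → α → Prop}
    {E : (ℕ → ℕ) → ℕ → ℕ} (hP : OracleDecidable P) (hE : OracleComputable E) :
    OracleDecidable fun t a => P (E t) a :=
  let ⟨_, hb, h⟩ := hP
  ⟨_, hb.subst hE, fun t a => h (E t) a⟩

/-- The join of two oracles. -/
def join (r p : ℕ → ℕ) (z : ℕ) : ℕ := if z % 2 = 0 then r (z / 2) else p (z / 2)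

/-- The first half of a join. -/
def joinFst (t : ℕ → ℕ) (i : ℕ) : ℕ := t (2 * i)

/-- The second half of a join. -/
def joinSnd (t : ℕ → ℕ) (i : ℕ) : ℕ := t (2 * i + 1)

theorem joinFst_join (r p : ℕ → ℕ) : joinFst (join r p) = r := by
  funext i
  simp [joinFst, join]

theorem joinSnd_join (r p : ℕ → ℕ) : joinSnd (join r p) = p := by
  funext i
  simp only [joinSnd, join]
  rw [if_neg (by omega)]
  congr 1
  omega

theorem oracleComputable_joinFst : OracleComputable joinFst :=
  .oracle (.of_primrec Primrec.nat_double)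

theorem oracleComputable_joinSnd : OracleComputable joinSnd :=
  .oracle (.of_primrec Primrec.nat_double_succ)

/-- The instance can be recovered from a basis: its value at `i` is read off the initial segment
that is part of the code of a basis vector with list code above `i`. -/
theorem exists_recover : ∃ Θ, ComputableFunctional Θ ∧
    ∀ (p : ℕ → ℕ) (B : Set (collapseVectorSpace p).vectors), (collapseVectorSpace p).IsBasis B →
      MapsTo Θ (charFun (Subtype.val '' B)) (join (charFun (Subtype.val '' B)) p) := by
  have hP : OracleDecidable fun r (x : ℕ × ℕ) => r x.2 = 1 ∧ x.1 < x.2.unpair.1 :=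
    .and (.eq (.oracle (.of_primrec .snd)) (.const 1))
      (.lt (.of_primrec .fst) (.unpair₁ (.of_primrec .snd)))
  have hz : Primrec fun x : ℕ × ℕ => x.1 / 2 := Primrec.nat_div.comp .fst (.const 2)
  have hl : Primrec fun x : ℕ × ℕ => Denumerable.ofNat (List ℕ) x.2.unpair.2 :=
    (Primrec.ofNat (List ℕ)).comp (Primrec.snd.comp (Primrec.unpair.comp .snd))
  have hG : OracleComputable fun r (x : ℕ × ℕ) => if x.1 % 2 = 0 then r (x.1 / 2)
      else (Denumerable.ofNat (List ℕ) x.2.unpair.2).getI (x.1 / 2) :=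
    .ite (.eq (.of_primrec (Primrec.nat_mod.comp .fst (.const 2))) (.const 0))
      (.oracle (.of_primrec hz)) (.of_primrec (Primrec.list_getI.comp hl hz))
  obtain ⟨Θ, hΘ, h⟩ := hP.exists_search hG
  refine ⟨Θ, hΘ, fun p B hB => ?_⟩
  obtain ⟨s, hs, hs'⟩ := h (charFun (Subtype.val '' B)) fun z => by
    obtain ⟨v, hv, hz⟩ := exists_mem_basis_gt hB z
    exact ⟨v, charFun_eq_one.2 ⟨v, hv, rfl⟩, hz⟩
  convert hs
  funext z
  obtain ⟨w, ⟨⟨hw, hzw⟩, -⟩, e⟩ := hs' z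
  obtain ⟨v, -, rfl⟩ := charFun_eq_one.1 hw
  rw [e, join]
  congr 1
  rw [coe_vector, vecCode, Nat.unpair_pair] at hzw ⊢
  simp only [Denumerable.ofNat_encode] at hzw ⊢
  have hlt := (Nat.div_le_self z 2).trans_lt hzw
  rw [List.getI_eq_getElem _ (by simpa using hlt)]
  simp

theorem oracleDecidable_isCertificate : OracleDecidable
    fun t (x : List (ℕ × ℕ) × ℕ × List ℕ × List ℕ) =>
      IsCertificate (joinSnd t) (joinFst t) x.1 x.2 := by
  have hsum : Primrec codeSum := by
    have : Primrec₂ fun (_ : List ℕ) (x : ℕ × List (ℕ × ℕ)) => vecAdd (codeList x.1) x.2 :=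
      primrec₂_vecAdd.comp (primrec_codeList.comp (.comp .fst .snd)) (.comp .snd .snd)
    exact Primrec.list_foldr .id (.const []) this
  have h1 : Primrec fun x : List (ℕ × ℕ) × ℕ × List ℕ × List ℕ => x.2.2.1 :=
    .comp .fst (.comp .snd .snd)
  have h2 : Primrec fun x : List (ℕ × ℕ) × ℕ × List ℕ × List ℕ => x.2.2.2 :=
    .comp .snd (.comp .snd .snd)
  have hone : OracleDecidable fun t (y : (List (ℕ × ℕ) × ℕ × List ℕ × List ℕ) × ℕ) =>
      joinFst t y.2 = 1 :=
    .eq (oracleComputable_joinFst.comp (.of_primrec .snd)) (.const 1)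
  have hleft : Primrec fun x : List (ℕ × ℕ) × ℕ × List ℕ × List ℕ =>
      vecAdd (vecSMul (ratNat (x.2.1 + 1)) x.1) (codeSum x.2.2.1) :=
    primrec₂_vecAdd.comp (primrec₂_vecSMul.comp (primrec_ratNat.comp (Primrec.succ.comp
      (.comp .fst .snd))) .fst) (hsum.comp h1)
  exact .and (.and (hone.forall_mem (.of_primrec h1)) (hone.forall_mem (.of_primrec h2)))
    ((oracleDecidable_vecEq.subst oracleComputable_joinSnd).comp
      (.pair (.of_primrec hleft) (.of_primrec (hsum.comp h2))))

/-- A number `k` together with certificates for the generators of the block of `(n, k)` such that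
`k` is not among the finitely many values of the `n`-th function that the certificates allow. -/
def IsAnswer (p r : ℕ → ℕ) (n : ℕ)
    (x : ℕ × (ℕ × List ℕ × List ℕ) × (ℕ × List ℕ × List ℕ)) : Prop :=
  (IsCertificate p r (blockFst (Nat.pair n x.1)) x.2.1 ∧
    IsCertificate p r (blockSnd (Nat.pair n x.1)) x.2.2) ∧
    ∀ s < (x.2.1.1 + 1) * (x.2.2.2.1.length + x.2.2.2.2.length) + 1, p (Nat.pair n s) ≠ x.1

theorem IsAnswer.ne {p : ℕ → ℕ} {B : Set (collapseVectorSpace p).vectors}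
    (hB : (collapseVectorSpace p).IsBasis B) {n : ℕ}
    {x : ℕ × (ℕ × List ℕ × List ℕ) × (ℕ × List ℕ × List ℕ)}
    (h : IsAnswer p (charFun (Subtype.val '' B)) n x) (j : ℕ) : p (Nat.pair n j) ≠ x.1 := by
  intro hj
  obtain ⟨s, hs⟩ := exists_firstHit hj
  refine h.2 s (Nat.lt_succ_of_le (hs.le_of_isCertificate hB h.1.1 h.1.2)) ?_
  simpa using hs.1

theorem oracleDecidable_isAnswer : OracleDecidable
    fun t (x : ℕ × ℕ × (ℕ × List ℕ × List ℕ) × (ℕ × List ℕ × List ℕ)) =>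
      IsAnswer (joinSnd t) (joinFst t) x.1 x.2 := by
  have hm : Primrec fun x : ℕ × ℕ × (ℕ × List ℕ × List ℕ) × (ℕ × List ℕ × List ℕ) =>
      Nat.pair x.1 x.2.1 := Primrec₂.natPair.comp .fst (.comp .fst .snd)
  have hc : Primrec fun x : ℕ × ℕ × (ℕ × List ℕ × List ℕ) × (ℕ × List ℕ × List ℕ) => x.2.2.1 :=
    .comp .fst (.comp .snd .snd)
  have hd : Primrec fun x : ℕ × ℕ × (ℕ × List ℕ × List ℕ) × (ℕ × List ℕ × List ℕ) => x.2.2.2 :=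
    .comp .snd (.comp .snd .snd)
  have hf : Primrec blockFst := primrec₂_vecSingle.comp .id (.const _)
  have hs : Primrec blockSnd := primrec₂_vecSingle.comp .id (.const _)
  have hbound : Primrec fun x : ℕ × ℕ × (ℕ × List ℕ × List ℕ) × (ℕ × List ℕ × List ℕ) =>
      (x.2.2.1.1 + 1) * (x.2.2.2.2.1.length + x.2.2.2.2.2.length) + 1 :=
    Primrec.succ.comp (Primrec.nat_mul.comp (Primrec.succ.comp (Primrec.fst.comp hc))
      (Primrec.nat_add.comp (Primrec.list_length.comp (Primrec.fst.comp (Primrec.snd.comp hd)))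
        (Primrec.list_length.comp (Primrec.snd.comp (Primrec.snd.comp hd)))))
  have hne : OracleDecidable fun t
      (y : (ℕ × ℕ × (ℕ × List ℕ × List ℕ) × (ℕ × List ℕ × List ℕ)) × ℕ) =>
      joinSnd t (Nat.pair y.1.1 y.2) ≠ y.1.2.1 :=
    .not (.eq (oracleComputable_joinSnd.comp (.natPair (.of_primrec (.comp .fst .fst))
      (.of_primrec .snd))) (.of_primrec (.comp .fst (.comp .snd .fst))))
  exact .and (.and
    (oracleDecidable_isCertificate.comp (.of_primrec ((hf.comp hm).pair hc)))
    (oracleDecidable_isCertificate.comp (.of_primrec ((hs.comp hm).pair hd))))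
    (hne.forall_lt (.of_primrec hbound))

theorem parallelization_closedChoice_reducible_VSBRat :
    StrongReducible (parallelization closedChoice) VSBRat := by
  let dec : ℕ → ℕ × (ℕ × List ℕ × List ℕ) × (ℕ × List ℕ × List ℕ) := Denumerable.ofNat _
  have hdec : Primrec fun x : ℕ × ℕ => dec x.2 := (Primrec.ofNat _).comp .snd
  obtain ⟨Ψ, hΨ, hΨs⟩ := OracleDecidable.exists_search
    (oracleDecidable_isAnswer.comp (.of_primrec (Primrec.fst.pair hdec)))
    (.of_primrec (Primrec.fst.comp hdec))
  obtain ⟨Θ, hΘ, hΘs⟩ := exists_recover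
  obtain ⟨Ψ', hΨ', hΨΘ⟩ := hΨ.subst hΘ
  refine ⟨_, Ψ', OracleComputable.nat_iff.1 oracleComputable_collapseCode, hΨ', fun p ⟨t, ht⟩ => ?_⟩
  have hcode := collapseVectorSpace_codedBy p
  rw [mem_parallelization_closedChoice] at ht
  refine ⟨_, fun n => Part.mem_some _, ⟨_, _, _, ⟨scalarEquiv p⟩, hcode, rfl,
    CountableVectorSpace.isBasis_greedy _⟩, fun r ⟨V, B, _, hV, hr, hB⟩ => ?_⟩
  obtain ⟨-, B, hBeq, hB⟩ := CountableVectorSpace.CodedBy.exists_isBasis hV hcode hB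
  obtain rfl : r = charFun (Subtype.val '' B) := hr.trans (congrArg charFun hBeq.symm)
  obtain ⟨s, hs, hs'⟩ := hΨs (join (charFun (Subtype.val '' B)) p) fun n => by
    rw [joinFst_join, joinSnd_join]
    obtain ⟨c, hc⟩ := exists_isCertificate hB (blockFst (Nat.pair n (t n)))
    obtain ⟨d, hd⟩ := exists_isCertificate hB (blockSnd (Nat.pair n (t n)))
    refine ⟨encode (t n, c, d), ?_⟩
    simp only [dec, Denumerable.ofNat_encode]
    exact ⟨⟨hc, hd⟩, fun s _ => ht n s⟩
  refine ⟨s, fun n => ?_, mem_parallelization_closedChoice.2 fun n => ?_⟩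
  · rw [hΨΘ _ _ (hΘs p B hB)]
    exact hs n
  · obtain ⟨w, ⟨hw, -⟩, hsw⟩ := hs' n
    rw [joinFst_join, joinSnd_join] at hw
    rw [hsw]
    exact hw.ne hB

end Weihrauch

theorem mainTheorem4 :
    Weihrauch.StrongEquiv Weihrauch.GAC Weihrauch.EMB ∧
    Weihrauch.StrongEquiv Weihrauch.EMB Weihrauch.VSB ∧
    Weihrauch.StrongEquiv Weihrauch.VSB (Weihrauch.parallelization Weihrauch.closedChoice) ∧
    Weihrauch.StrongEquiv Weihrauch.VSBRat
      (Weihrauch.parallelization Weihrauch.closedChoice) := by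
  have gac := Weihrauch.GAC_reducible_parallelization_closedChoice
  have emb := Weihrauch.EMB_reducible_parallelization_closedChoice
  have vsb := Weihrauch.VSB_reducible_parallelization_closedChoice
  have rat := Weihrauch.VSBRat_reducible_VSB
  have toGAC := Weihrauch.parallelization_closedChoice_reducible_GAC
  have toEMB := Weihrauch.parallelization_closedChoice_reducible_EMB
  have toRat := Weihrauch.parallelization_closedChoice_reducible_VSBRat
  have toVSB := toRat.trans rat
  exact ⟨⟨gac.trans toEMB, emb.trans toGAC⟩, ⟨emb.trans toVSB, vsb.trans toEMB⟩, ⟨vsb, toVSB⟩,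
    ⟨rat.trans vsb, toRat⟩⟩
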